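/- Let $V$ be a finite nonempty set of $n$ parties, each party $v$ holding a quantum system of finite dimension, and let $G$ be a $k$-network on $V$, i.e. a hypergraph with vertex set $V$ all of whose hyperedges $e\in E$ satisfy $|e|\le k$; assume $k\ge 1$ and $n+k>2$. Let $\mathcal S_{\rm I}$ be the closure of the set of all states $\bigl(\bigotimes_{v\in V} C_v\bigr)\bigl(\bigotimes_{e\in E}\gamma_e\bigr)$, where $\gamma_e$ is an arbitrary state of finite dimension shared by the parties in $e$, and $C_v$ is a quantum channel mapping all the particles received by party $v$ to the system of $v$ (no shared randomness). For a state $\rho$ of the $n$ parties put $$\bar{\mathcal E}_{\rm tr}(\rho)=\inf \sum_t p_t\,\tfrac12|\rho_t-\sigma_t|_1 ,$$ where the infimum is over all finite convex decompositions $\rho=\sum_t p_t\rho_t$ into states $\rho_t$ and all $\sigma_t\in\mathcal S_{\rm I}$, and $|\cdot|_1$ is the trace norm. For every $v$ let $M_v$ be the observable of a $\pm1$-measurement on party $v$ (a Hermitian operator with eigenvalues in $[-1,1]$), and put $$\Gamma_{ij}(\rho)=\operatorname{tr}(\rho M_iM_j)-\operatorname{tr}(\rho M_i)\operatorname{tr}(\rho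 M_j),\qquad \omega(\rho)=\sum_{i,j\in V}\Gamma_{ij}(\rho)-k\operatorname{tr}\Gamma(\rho),$$ $$\beta(\rho)=\min\bigl\{r(1-\tau),\,2\sqrt{1-\tau^2}\bigr\},\qquad \tau=\operatorname{tr}(\rho^2),\quad r=\operatorname{rank}\rho .$$ Then for every state $\rho$ $$\bar{\mathcal E}_{\rm tr}(\rho)\ \ge\ \frac{\omega(\rho)}{6n(n+k-2)}-\frac{\beta(\rho)}{6}.$$ -/

import Mathlib

noncomputable section

namespace QNet

open scoped ComplexOrder
open Matrix

/-- A quantum state (density matrix) in the computational basis indexed by `I`. -/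
def IsState {I : Type*} [Fintype I] (ρ : Matrix I I ℂ) : Prop :=
  ρ.PosSemidef ∧ ρ.trace = 1

/-- The trace norm `|A|₁ = tr √(A† A)`: the sum of the singular values of `A`. -/
def traceNorm {I : Type*} [Fintype I] [DecidableEq I] (A : Matrix I I ℂ) : ℝ :=
  ∑ i, Real.sqrt ((isHermitian_conjTranspose_mul_self A).eigenvalues i)

/-- A finite family of Kraus operators, i.e. a representation
`X ↦ ∑ i, A i * X * (A i)ᴴ` of a quantum channel from the system `K` to the system `H`. -/
def IsKraus {K H : Type*} [Fintype K] [DecidableEq K] [Fintype H] {m : ℕ}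
    (A : Fin m → Matrix H K ℂ) : Prop :=
  ∑ i, (A i)ᴴ * A i = 1

section Tensor

variable {V : Type*} [Fintype V]

/-- The tensor product over all parties `v : V` of local operators `A v : ℂ^(K v) → ℂ^(H v)`. -/
def tensorOp {K H : V → Type*} (A : ∀ v, Matrix (H v) (K v) ℂ) :
    Matrix (∀ v, H v) (∀ v, K v) ℂ :=
  Matrix.of fun x y => ∏ v, A v (x v) (y v)

/-- The operator of the whole system which acts as `B` on party `v` and trivially elsewhere. -/
def localOp [DecidableEq V] {H : V → Type*} [∀ v, DecidableEq (H v)] (v : V)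
    (B : Matrix (H v) (H v) ℂ) : Matrix (∀ v, H v) (∀ v, H v) ℂ :=
  tensorOp (Function.update (fun w => (1 : Matrix (H w) (H w) ℂ)) v B)

end Tensor

section Network

variable {V : Type*} [Fintype V] [DecidableEq V]

/-- A network with parties `V` is a hypergraph, given by its set `E` of hyperedges (sources).
It is a `k`-network if every source is at most `k`-partite. -/
def IsKNetwork (k : ℕ) (E : Finset (Finset V)) : Prop :=
  ∀ e ∈ E, e.card ≤ k

/-- Basis of the system emitted by source `e`: one particle, of dimension `D e v`, for every
party `v ∈ e`. -/
abbrev SourceIdx (D : Finset V → V → ℕ) (e : Finset V) : Type _ :=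
  ∀ v : {v : V // v ∈ e}, Fin (D e v)

/-- Basis of the system received by party `v`: one particle from every source `e ∋ v`. -/
abbrev PartyIdx (E : Finset (Finset V)) (D : Finset V → V → ℕ) (v : V) : Type _ :=
  ∀ e : {e : Finset V // e ∈ E ∧ v ∈ e}, Fin (D e v)

/-- The state `⨂_{e ∈ E} γ e` distributed by the network, with the particles grouped by party. -/
def sourceState (E : Finset (Finset V)) (D : Finset V → V → ℕ)
    (γ : ∀ e : {e : Finset V // e ∈ E}, Matrix (SourceIdx D e) (SourceIdx D e) ℂ) :
    Matrix (∀ v, PartyIdx E D v) (∀ v, PartyIdx E D v) ℂ :=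
  Matrix.of fun x y => ∏ e : {e : Finset V // e ∈ E},
    γ e (fun v => x v ⟨e.1, e.2, v.2⟩) (fun v => y v ⟨e.1, e.2, v.2⟩)

/-- The action on `τ` of the product `⨂_v C_v` of the local channels `C_v` with Kraus operators
`A v 0, …, A v (m v - 1)`. -/
def applyLocal {K H : V → Type*} [∀ v, Fintype (K v)] {m : V → ℕ}
    (A : ∀ v, Fin (m v) → Matrix (H v) (K v) ℂ)
    (τ : Matrix (∀ v, K v) (∀ v, K v) ℂ) : Matrix (∀ v, H v) (∀ v, H v) ℂ :=
  ∑ i : ∀ v, Fin (m v), tensorOp (fun v => A v (i v)) * τ * (tensorOp (fun v => A v (i v)))ᴴ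

variable {H : V → Type*} [∀ v, Fintype (H v)] [∀ v, DecidableEq (H v)]

/-- States obtained from independent source states of arbitrary finite dimension, one for each
hyperedge, by local channels and without shared randomness. -/
def preparable (H : V → Type*) [∀ v, Fintype (H v)] (E : Finset (Finset V)) :
    Set (Matrix (∀ v, H v) (∀ v, H v) ℂ) :=
  {σ | ∃ (D : Finset V → V → ℕ)
      (γ : ∀ e : {e : Finset V // e ∈ E}, Matrix (SourceIdx D e) (SourceIdx D e) ℂ)
      (m : V → ℕ) (A : ∀ v, Fin (m v) → Matrix (H v) (PartyIdx E D v) ℂ),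
      (∀ e, IsState (γ e)) ∧ (∀ v, IsKraus (A v)) ∧
      σ = applyLocal A (sourceState E D γ)}

/-- `S_I(G)`: the closure of the set of preparable states. -/
def netStates (H : V → Type*) [∀ v, Fintype (H v)] (E : Finset (Finset V)) :
    Set (Matrix (∀ v, H v) (∀ v, H v) ℂ) :=
  closure (preparable H E)

/-- The values `∑ t, p t * |ρ t - σ t|₁ / 2`, over all finite decompositions
`ρ = ∑ t, p t • ρ t` into states and all choices of `σ t ∈ S_I(G)`. -/
def trValues (E : Finset (Finset V)) (ρ : Matrix (∀ v, H v) (∀ v, H v) ℂ) : Set ℝ :=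
  {x | ∃ (N : ℕ) (p : Fin N → ℝ) (ρt σt : Fin N → Matrix (∀ v, H v) (∀ v, H v) ℂ),
      (∀ t, 0 ≤ p t) ∧ ∑ t, p t = 1 ∧ (∀ t, IsState (ρt t)) ∧
      ρ = ∑ t, (p t : ℂ) • ρt t ∧ (∀ t, σt t ∈ netStates H E) ∧
      x = ∑ t, p t * (traceNorm (ρt t - σt t) / 2)}

/-- The averaged trace-distance measure `Ē_tr(ρ)` of network-entanglement. -/
def Etr (E : Finset (Finset V)) (ρ : Matrix (∀ v, H v) (∀ v, H v) ℂ) : ℝ :=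
  sInf (trValues E ρ)

/-- Every network prepares some state. -/
theorem preparable_nonempty (E : Finset (Finset V)) [hH : ∀ v, Nonempty (H v)] :
    (preparable H E).Nonempty := by
  classical
  refine ⟨_, fun _ _ => 1, fun _ => 1, fun _ => 1,
    fun v _ => Matrix.of fun x _ => if x = (hH v).some then 1 else 0, ?_, ?_, rfl⟩
  · intro e
    refine ⟨PosSemidef.one, ?_⟩
    simp [SourceIdx]
  · intro v
    unfold IsKraus
    ext x y
    have hxy : x = y := Subsingleton.elim _ _
    subst hxy
    rw [Matrix.sum_apply, Fintype.sum_eq_single 0 (fun i hi => absurd (Subsingleton.elim i 0) hi),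
      Matrix.mul_apply, Matrix.one_apply_eq]
    simp [Matrix.conjTranspose_apply]

/-- The infimum defining `Etr` is over a nonempty set of nonnegative numbers. -/
theorem trValues_nonempty (E : Finset (Finset V)) {ρ : Matrix (∀ v, H v) (∀ v, H v) ℂ}
    (hρ : IsState ρ) : (trValues E ρ).Nonempty := by
  have hne : Nonempty (∀ v, H v) := by
    by_contra h
    rw [not_nonempty_iff] at h
    have h1 := hρ.2
    simp [Matrix.trace] at h1
  have hH : ∀ v, Nonempty (H v) := fun v => ⟨hne.some v⟩
  obtain ⟨σ, hσ⟩ := preparable_nonempty (H := H) E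
  exact ⟨_, 1, fun _ => 1, fun _ => ρ, fun _ => σ, fun _ => zero_le_one, by simp,
    fun _ => hρ, by simp, fun _ => subset_closure hσ, rfl⟩

theorem trValues_nonneg (E : Finset (Finset V)) (ρ : Matrix (∀ v, H v) (∀ v, H v) ℂ)
    {x : ℝ} (hx : x ∈ trValues E ρ) : 0 ≤ x := by
  obtain ⟨N, p, ρt, σt, hp, -, -, -, -, rfl⟩ := hx
  exact Finset.sum_nonneg fun t _ => mul_nonneg (hp t)
    (div_nonneg (Finset.sum_nonneg fun _ _ => Real.sqrt_nonneg _) zero_le_two)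

/-- A `±1`-measurement of every party, given by its observable `M v = P₊ - P₋`, where
`P₊ + P₋ = 1`; equivalently, `M v` is Hermitian with eigenvalues in `[-1, 1]`. -/
def IsMeasurement (M : ∀ v, Matrix (H v) (H v) ℂ) : Prop :=
  ∀ v, ∃ P Q : Matrix (H v) (H v) ℂ,
    P.PosSemidef ∧ Q.PosSemidef ∧ P + Q = 1 ∧ M v = P - Q

/-- The covariance matrix `Γ_ij(ρ) = tr(ρ M_i M_j) - tr(ρ M_i) tr(ρ M_j)`. -/
def cov (M : ∀ v, Matrix (H v) (H v) ℂ) (ρ : Matrix (∀ v, H v) (∀ v, H v) ℂ) :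
    Matrix V V ℝ :=
  Matrix.of fun i j => (ρ * (localOp i (M i) * localOp j (M j))).trace.re
    - (ρ * localOp i (M i)).trace.re * (ρ * localOp j (M j)).trace.re

/-- `ω(ρ) = ∑_ij Γ_ij(ρ) - k tr Γ(ρ)`. -/
def omega (k : ℕ) (M : ∀ v, Matrix (H v) (H v) ℂ) (ρ : Matrix (∀ v, H v) (∀ v, H v) ℂ) : ℝ :=
  ∑ i, ∑ j, cov M ρ i j - k * (cov M ρ).trace

end Network

/-- `β(ρ) = min {r (1 - τ), 2 √(1 - τ²)}` with `τ = tr ρ²` and `r` the rank of `ρ`. -/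
def beta {I : Type*} [Fintype I] (ρ : Matrix I I ℂ) : ℝ :=
  min (ρ.rank * (1 - (ρ * ρ).trace.re)) (2 * Real.sqrt (1 - (ρ * ρ).trace.re ^ 2))

end QNet

end

/-! The functional ω is at most zero on network states, varies slowly in trace norm, and loses
little under convex decomposition. Averaging these facts over a decomposition `ρ = ∑ p t • ρt t`
gives the bound.

Sign (`omega_nonpos_of_mem_netStates`): in the Heisenberg picture local channels keep off-diagonal
covariances and can only raise the variances, whose weight in ω is 1 - k ≤ 0; so it suffices to
treat the source state itself. Purify each source. In the product vector ψ, replace the identity by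
the projection onto the source vectors, one source at a time. For X = ∑ X_v, the variance ‖Xψ‖² -
|⟨ψ, Xψ⟩|² telescopes into squared increments, as in the Efron–Stein inequality. Each increment
involves at most k parties, so Cauchy–Schwarz costs a factor k, and ∑ Γ_ij ≤ k tr Γ.

Continuity (`omega_le_traceNorm`): each covariance moves by at most 3|ρ - σ|₁, and the absolute
coefficients of ω sum to n(n - 1) + n(k - 1) = n(n + k - 2).

Mixing (`omega_sub_average_le`): ω(ρ) - ∑ p_t ω(ρ_t) only involves the classical covariances of the
local means over t. The variances of those means are at most β(ρ)
(`IsDecomposition.variance_le_beta`). -/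

noncomputable section

namespace QNet

open scoped ComplexOrder
open Matrix

/-! ### Tensor products of local operators -/

section TensorAlgebra

variable {V : Type*} [Fintype V] {H K L : V → Type*}

theorem tensorOp_apply (A : ∀ v, Matrix (H v) (K v) ℂ) (x : ∀ v, H v) (y : ∀ v, K v) :
    tensorOp A x y = ∏ v, A v (x v) (y v) := rfl

theorem tensorOp_conjTranspose (A : ∀ v, Matrix (H v) (K v) ℂ) :
    (tensorOp A)ᴴ = tensorOp fun v => (A v)ᴴ := by
  ext x y
  simp [tensorOp_apply, conjTranspose_apply]

theorem tensorOp_mul [DecidableEq V] [∀ v, Fintype (K v)] (A : ∀ v, Matrix (H v) (K v) ℂ)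
    (B : ∀ v, Matrix (K v) (L v) ℂ) :
    tensorOp A * tensorOp B = tensorOp fun v => A v * B v := by
  ext x y
  simp only [tensorOp_apply, mul_apply, Finset.prod_univ_sum, Fintype.piFinset_univ,
    Finset.prod_mul_distrib]

theorem tensorOp_one [∀ v, DecidableEq (H v)] :
    tensorOp (fun v => (1 : Matrix (H v) (H v) ℂ)) = 1 := by
  ext x y
  simp only [tensorOp_apply, one_apply, Finset.prod_ite_zero, Finset.prod_const_one,
    Finset.mem_univ, true_implies, funext_iff]

theorem trace_tensorOp [DecidableEq V] [∀ v, Fintype (H v)] (A : ∀ v, Matrix (H v) (H v) ℂ) :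
    (tensorOp A).trace = ∏ v, (A v).trace := by
  simp only [trace, diag_apply, tensorOp_apply, Finset.prod_univ_sum, Fintype.piFinset_univ]

theorem sum_tensorOp [DecidableEq V] {m : V → ℕ} (A : ∀ v, Fin (m v) → Matrix (H v) (K v) ℂ) :
    ∑ i : ∀ v, Fin (m v), tensorOp (fun v => A v (i v)) = tensorOp fun v => ∑ a, A v a := by
  ext x y
  simp only [tensorOp_apply, Matrix.sum_apply, Finset.prod_univ_sum, Fintype.piFinset_univ]

theorem tensorOp_posSemidef [DecidableEq V] [∀ v, Fintype (H v)]
    {A : ∀ v, Matrix (H v) (H v) ℂ} {G : ∀ v, Matrix (H v) (H v) ℂ}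
    (h : ∀ v, A v = G v * (G v)ᴴ) : (tensorOp A).PosSemidef := by
  have : tensorOp A = tensorOp G * (tensorOp G)ᴴ := by
    rw [tensorOp_conjTranspose, tensorOp_mul]
    exact congrArg tensorOp (funext h)
  rw [this]
  exact posSemidef_self_mul_conjTranspose _

variable [DecidableEq V] [∀ v, DecidableEq (H v)]

theorem localOp_one (v : V) : localOp v (1 : Matrix (H v) (H v) ℂ) = 1 := by
  rw [localOp, Function.update_eq_self_iff.2 rfl, tensorOp_one]

theorem localOp_apply (v : V) (B : Matrix (H v) (H v) ℂ) (x y : ∀ v, H v) :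
    localOp v B x y = B (x v) (y v) * if ∀ w, w ≠ v → x w = y w then 1 else 0 := by
  rw [localOp, tensorOp_apply, ← Finset.mul_prod_erase _ _ (Finset.mem_univ v),
    Function.update_self]
  congr 1
  rw [Finset.prod_congr rfl (g := fun w => if x w = y w then (1 : ℂ) else 0)]
  · simp only [Finset.prod_ite_zero, Finset.prod_const_one, Finset.mem_erase, Finset.mem_univ,
      and_true]
  · intro w hw
    rw [Function.update_of_ne (Finset.ne_of_mem_erase hw), one_apply]

theorem localOp_add (v : V) (A B : Matrix (H v) (H v) ℂ) :
    localOp v (A + B) = localOp v A + localOp v B := by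
  ext x y
  simp only [localOp_apply, Matrix.add_apply, add_mul]

theorem localOp_sub (v : V) (A B : Matrix (H v) (H v) ℂ) :
    localOp v (A - B) = localOp v A - localOp v B := by
  ext x y
  simp only [localOp_apply, Matrix.sub_apply, sub_mul]

theorem localOp_conjTranspose (v : V) (A : Matrix (H v) (H v) ℂ) :
    (localOp v A)ᴴ = localOp v Aᴴ := by
  rw [localOp, tensorOp_conjTranspose, localOp]
  congr 1
  funext w
  by_cases h : w = v
  · subst h; simp
  · simp [Function.update_of_ne h]

variable [∀ v, Fintype (H v)]

theorem localOp_mul (v : V) (A B : Matrix (H v) (H v) ℂ) :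
    localOp v A * localOp v B = localOp v (A * B) := by
  rw [localOp, localOp, tensorOp_mul, localOp]
  congr 1
  funext w
  by_cases h : w = v
  · subst h; simp
  · simp [Function.update_of_ne h]

theorem localOp_mul_of_ne {v w : V} (h : v ≠ w) (A : Matrix (H v) (H v) ℂ)
    (B : Matrix (H w) (H w) ℂ) :
    localOp v A * localOp w B =
      tensorOp (Function.update (Function.update (fun u => (1 : Matrix (H u) (H u) ℂ)) v A) w B) := by
  rw [localOp, localOp, tensorOp_mul]
  congr 1
  funext u
  by_cases hw : u = w
  · subst hw; simp [Function.update_of_ne (Ne.symm h)]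
  · by_cases hv : u = v
    · subst hv; simp [Function.update_of_ne hw]
    · simp [Function.update_of_ne hw, Function.update_of_ne hv]

theorem exists_eq_mul_conjTranspose {I : Type*} [Fintype I] {A : Matrix I I ℂ}
    (hA : A.PosSemidef) : ∃ G : Matrix I I ℂ, A = G * Gᴴ := by
  classical
  open scoped MatrixOrder in
  obtain ⟨G, hG⟩ := CStarAlgebra.nonneg_iff_eq_mul_star_self.1 hA.nonneg
  exact ⟨G, hG⟩

theorem localOp_posSemidef (v : V) {A : Matrix (H v) (H v) ℂ} (hA : A.PosSemidef) :
    (localOp v A).PosSemidef := by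
  obtain ⟨G, rfl⟩ := exists_eq_mul_conjTranspose hA
  rw [← localOp_mul, ← localOp_conjTranspose]
  exact posSemidef_self_mul_conjTranspose _

end TensorAlgebra

/-! ### Observables and contractions -/

section Observables

theorem re_trace_mul_nonneg {I : Type*} [Fintype I] {A B : Matrix I I ℂ} (hA : A.PosSemidef) (hB : B.PosSemidef) :
    0 ≤ (A * B).trace.re := by
  obtain ⟨G, rfl⟩ := exists_eq_mul_conjTranspose hB
  rw [← mul_assoc, trace_mul_comm, ← mul_assoc]
  exact (Complex.le_def.1 (hA.conjTranspose_mul_mul_same G).trace_nonneg).1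

variable {I : Type*} [Fintype I] [DecidableEq I]

/-- A `±1`-observable: a difference of two complementary effects. -/
def IsObs (B : Matrix I I ℂ) : Prop :=
  ∃ P Q : Matrix I I ℂ, P.PosSemidef ∧ Q.PosSemidef ∧ P + Q = 1 ∧ B = P - Q

/-- An operator `B` with `Bᴴ * B ≤ 1`. -/
def IsContraction (B : Matrix I I ℂ) : Prop :=
  (1 - Bᴴ * B).PosSemidef

omit [Fintype I] in
theorem IsObs.isHermitian {B : Matrix I I ℂ} (hB : IsObs B) : Bᴴ = B := by
  obtain ⟨P, Q, hP, hQ, -, rfl⟩ := hB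
  rw [conjTranspose_sub, hP.1, hQ.1]

theorem IsObs.isContraction {B : Matrix I I ℂ} (hB : IsObs B) : IsContraction B := by
  have hH := hB.isHermitian
  obtain ⟨P, Q, hP, hQ, h, rfl⟩ := hB
  rw [IsContraction, hH]
  obtain rfl : Q = 1 - P := eq_sub_of_add_eq' h
  have h1 := hP.mul_mul_conjTranspose_same (1 - P)
  have h2 := hQ.mul_mul_conjTranspose_same P
  rw [hQ.1] at h1
  rw [hP.1] at h2
  -- As P and Q commute and sum to 1, 1 - (P - Q)² = 4PQ = 4(QPQ + PQP).
  have h3 := ((h1.add h2).add (h1.add h2)).add ((h1.add h2).add (h1.add h2))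
  convert h3 using 1
  noncomm_ring

/-- 1 - (AB)ᴴAB = (1 - BᴴB) + Bᴴ(1 - AᴴA)B. This covers the product `M_i M_j`, also for i = j. -/
theorem IsContraction.mul {A B : Matrix I I ℂ} (hA : IsContraction A) (hB : IsContraction B) :
    IsContraction (A * B) := by
  have h := hB.add (hA.conjTranspose_mul_mul_same B)
  rw [IsContraction, conjTranspose_mul]
  convert h using 1
  noncomm_ring

theorem abs_re_trace_mul_obs_le {ρ B : Matrix I I ℂ} (hρ : IsState ρ) (hB : IsObs B) :
    |(ρ * B).trace.re| ≤ 1 := by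
  obtain ⟨P, Q, hP, hQ, h, rfl⟩ := hB
  have h1 := re_trace_mul_nonneg hρ.1 hP
  have h2 := re_trace_mul_nonneg hρ.1 hQ
  have h3 : (ρ * P).trace.re + (ρ * Q).trace.re = 1 := by
    rw [← Complex.add_re, ← trace_add, ← mul_add, h, mul_one, hρ.2, Complex.one_re]
  rw [mul_sub, trace_sub, Complex.sub_re, abs_le]
  constructor <;> linarith

theorem IsObs.localOp {V : Type*} [Fintype V] [DecidableEq V] {H : V → Type*}
    [∀ v, Fintype (H v)] [∀ v, DecidableEq (H v)] {v : V} {B : Matrix (H v) (H v) ℂ}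
    (hB : IsObs B) : IsObs (localOp v B) := by
  obtain ⟨P, Q, hP, hQ, h, rfl⟩ := hB
  exact ⟨_, _, localOp_posSemidef v hP, localOp_posSemidef v hQ,
    by rw [← localOp_add, h, localOp_one], localOp_sub v P Q⟩

theorem norm_mulVec_le {B : Matrix I I ℂ} (hB : IsContraction B) (x : EuclideanSpace ℂ I) :
    ‖toEuclideanCLM (n := I) (𝕜 := ℂ) B x‖ ≤ ‖x‖ := by
  have h := hB.re_dotProduct_nonneg x.ofLp
  have h1 : ∀ A : Matrix I I ℂ, star x.ofLp ⬝ᵥ (A *ᵥ x.ofLp)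
      = inner ℂ x (toEuclideanCLM (n := I) (𝕜 := ℂ) A x) := by
    intro A
    rw [EuclideanSpace.inner_eq_star_dotProduct, dotProduct_comm, ofLp_toEuclideanCLM]
  rw [h1, map_sub, map_mul, map_one, ← star_eq_conjTranspose, map_star,
    _root_.sub_apply, inner_sub_right, mul_apply_eq_comp,
    ContinuousLinearMap.star_eq_adjoint, ContinuousLinearMap.adjoint_inner_right,
    one_apply_eq_self, map_sub, inner_self_eq_norm_sq, inner_self_eq_norm_sq] at h
  exact le_of_sq_le_sq (by linarith) (norm_nonneg _)

end Observables

/-! ### Trace-norm duality -/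

section TraceNorm

variable {I : Type*} [Fintype I] [DecidableEq I]

theorem trace_eq_sum_inner {ι : Type*} [Fintype ι] (A : Matrix I I ℂ)
    (b : OrthonormalBasis ι ℂ (EuclideanSpace ℂ I)) :
    A.trace = ∑ i, inner ℂ (b i) (toEuclideanCLM (n := I) (𝕜 := ℂ) A (b i)) := by
  have h := LinearMap.trace_eq_sum_inner (toEuclideanLin A) b
  rw [← Matrix.coe_toEuclideanCLM_eq_toEuclideanLin] at h
  rw [← ContinuousLinearMap.coe_coe, ← h, Matrix.coe_toEuclideanCLM_eq_toEuclideanLin,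
    toEuclideanLin_eq_toLin_orthonormal, trace_toLin_eq]

theorem inner_toEuclideanCLM_mul (A B : Matrix I I ℂ) (x y : EuclideanSpace ℂ I) :
    inner ℂ x (toEuclideanCLM (n := I) (𝕜 := ℂ) (Aᴴ * B) y) =
      inner ℂ (toEuclideanCLM (n := I) (𝕜 := ℂ) A x) (toEuclideanCLM (n := I) (𝕜 := ℂ) B y) := by
  rw [map_mul, ← star_eq_conjTranspose, map_star, mul_apply_eq_comp,
    ContinuousLinearMap.star_eq_adjoint, ContinuousLinearMap.adjoint_inner_right]

theorem toEuclideanCLM_eigenvectorBasis {A : Matrix I I ℂ} (hA : A.IsHermitian) (i : I) :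
    toEuclideanCLM (n := I) (𝕜 := ℂ) A (hA.eigenvectorBasis i)
      = (hA.eigenvalues i : ℂ) • hA.eigenvectorBasis i := by
  have h := hA.mulVec_eigenvectorBasis i
  apply (WithLp.ofLp_injective 2)
  rw [ofLp_toEuclideanCLM, h]
  ext j
  simp

/-- In an eigenbasis b_i of XᴴX, each diagonal entry of BX is at most ‖BXb_i‖ ≤ ‖Xb_i‖, which is the
i-th singular value. -/
theorem abs_re_trace_mul_le_traceNorm (X : Matrix I I ℂ) {B : Matrix I I ℂ}
    (hB : IsContraction B) : |(X * B).trace.re| ≤ traceNorm X := by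
  set hX := isHermitian_conjTranspose_mul_self X
  rw [trace_mul_comm, trace_eq_sum_inner _ hX.eigenvectorBasis, Complex.re_sum]
  refine (Finset.abs_sum_le_sum_abs _ _).trans (Finset.sum_le_sum fun i _ => ?_)
  refine (Complex.abs_re_le_norm _).trans ((norm_inner_le_norm _ _).trans ?_)
  rw [hX.eigenvectorBasis.orthonormal.1 i, one_mul, map_mul, mul_apply_eq_comp]
  refine (norm_mulVec_le hB _).trans (Real.le_sqrt_of_sq_le (le_of_eq ?_))
  have h := inner_toEuclideanCLM_mul X X (hX.eigenvectorBasis i) (hX.eigenvectorBasis i)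
  rw [toEuclideanCLM_eigenvectorBasis hX, inner_smul_right, inner_self_eq_norm_sq_to_K,
    inner_self_eq_norm_sq_to_K, hX.eigenvectorBasis.orthonormal.1 i] at h
  simp only [Complex.coe_algebraMap, Complex.ofReal_one, one_pow, mul_one] at h
  exact_mod_cast h.symm

end TraceNorm

/-! ### Variance of a mean over a convex decomposition -/

section Variance

theorem sum_mul_sub_sq {ι : Type*} [Fintype ι] {w x : ι → ℝ} {m : ℝ} (hw : ∑ i, w i = 1)
    (hm : ∑ i, w i * x i = m) : ∑ i, w i * (x i - m) ^ 2 = ∑ i, w i * x i ^ 2 - m ^ 2 := by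
  have : ∀ i, w i * (x i - m) ^ 2 = w i * x i ^ 2 - 2 * m * (w i * x i) + m ^ 2 * w i :=
    fun i => by ring
  simp only [this, Finset.sum_add_distrib, Finset.sum_sub_distrib, ← Finset.mul_sum, hm, hw]
  ring

/-- Jensen's inequality for the square; it carries an overlap bound from pure states to mixtures. -/
theorem sub_sq_le_of_average {ι : Type*} [Fintype ι] {w x y : ι → ℝ} {c : ℝ}
    (hw0 : ∀ i, 0 ≤ w i) (hw : ∑ i, w i = 1) (h : ∀ i, (x i - c) ^ 2 ≤ 4 * (1 - y i)) :
    (∑ i, w i * x i - c) ^ 2 ≤ 4 * (1 - ∑ i, w i * y i) := by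
  have h1 : ∑ i, w i * (x i - c) = ∑ i, w i * x i - c := by
    simp only [mul_sub, Finset.sum_sub_distrib, ← Finset.sum_mul, hw, one_mul]
  have h2 := sum_mul_sub_sq hw h1
  have h3 : 0 ≤ ∑ i, w i * (x i - c - (∑ i, w i * x i - c)) ^ 2 :=
    Finset.sum_nonneg fun i _ => mul_nonneg (hw0 i) (sq_nonneg _)
  have h4 : ∑ i, w i * (x i - c) ^ 2 ≤ ∑ i, w i * (4 * (1 - y i)) :=
    Finset.sum_le_sum fun i _ => mul_le_mul_of_nonneg_left (h i) (hw0 i)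
  have h5 : ∑ i, w i * (4 * (1 - y i)) = 4 * (1 - ∑ i, w i * y i) := by
    have : ∀ i, w i * (4 * (1 - y i)) = 4 * w i - 4 * (w i * y i) := fun i => by ring
    simp only [this, Finset.sum_sub_distrib, ← Finset.mul_sum, hw]
    ring
  linarith

variable {I : Type*} [Fintype I] [DecidableEq I]

/-- After a phase change making ⟨u, w⟩ real and nonnegative, the difference is Re⟨u + w, B(u - w)⟩,
and ‖u + w‖²‖u - w‖² = 4(1 - |⟨u, w⟩|²). -/
theorem re_inner_sub_sq_le {B : Matrix I I ℂ} (hB : IsContraction B) (hH : Bᴴ = B)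
    {u w : EuclideanSpace ℂ I} (hu : ‖u‖ = 1) (hw : ‖w‖ = 1) :
    ((inner ℂ u (toEuclideanCLM (n := I) (𝕜 := ℂ) B u)).re
      - (inner ℂ w (toEuclideanCLM (n := I) (𝕜 := ℂ) B w)).re) ^ 2
      ≤ 4 * (1 - ‖inner ℂ u w‖ ^ 2) := by
  set T := toEuclideanCLM (n := I) (𝕜 := ℂ) B with hT
  obtain ⟨c, hc, hcu⟩ : ∃ c : ℂ, ‖c‖ = 1 ∧ c * inner ℂ u w = (‖inner ℂ u w‖ : ℂ) := by
    obtain h | h := eq_or_ne (inner ℂ u w) 0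
    · exact ⟨1, by simp, by simp [h]⟩
    · refine ⟨‖inner ℂ u w‖ / inner ℂ u w, ?_, div_mul_cancel₀ _ h⟩
      rw [norm_div, Complex.norm_real, norm_norm, div_self (norm_ne_zero_iff.2 h)]
  have hcc : (starRingEnd ℂ) c * c = 1 := by
    rw [← Complex.normSq_eq_conj_mul_self, Complex.normSq_eq_norm_sq, hc]; simp
  have hsymm : ∀ x y, inner ℂ (T x) y = inner ℂ x (T y) := fun x y => by
    rw [← ContinuousLinearMap.adjoint_inner_right, ← ContinuousLinearMap.star_eq_adjoint, hT,
      ← map_star, star_eq_conjTranspose, hH]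
  have h1 : inner ℂ (c • w) (T (c • w)) = inner ℂ w (T w) := by
    rw [map_smul, inner_smul_left, inner_smul_right, ← mul_assoc, hcc, one_mul]
  have h2 : inner ℂ u (c • w) = (‖inner ℂ u w‖ : ℂ) := by
    rw [inner_smul_right, hcu]
  have hw' : ‖c • w‖ = 1 := by rw [norm_smul, hc, hw, one_mul]
  rw [← h1]
  generalize c • w = w' at *
  have h3 : (inner ℂ (u + w') (T (u - w'))).re
      = (inner ℂ u (T u)).re - (inner ℂ w' (T w')).re := by
    have : (inner ℂ w' (T u)).re = (inner ℂ u (T w')).re := by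
      rw [← hsymm, ← inner_conj_symm, Complex.conj_re]
    rw [map_sub, inner_add_left, inner_sub_right, inner_sub_right]
    simp only [Complex.add_re, Complex.sub_re, this]
    ring
  have h4 : |(inner ℂ (u + w') (T (u - w'))).re| ≤ ‖u + w'‖ * ‖u - w'‖ :=
    (Complex.abs_re_le_norm _).trans ((norm_inner_le_norm _ _).trans
      (mul_le_mul_of_nonneg_left (norm_mulVec_le hB _) (norm_nonneg _)))
  have h5 : ‖u + w'‖ ^ 2 = 2 + 2 * ‖inner ℂ u w‖ := by
    rw [norm_add_sq (𝕜 := ℂ), hu, hw', h2]; simp; ring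
  have h6 : ‖u - w'‖ ^ 2 = 2 - 2 * ‖inner ℂ u w‖ := by
    rw [norm_sub_sq (𝕜 := ℂ), hu, hw', h2]; simp; ring
  rw [← h3, ← sq_abs]
  calc _ ≤ (‖u + w'‖ * ‖u - w'‖) ^ 2 := pow_le_pow_left₀ (abs_nonneg _) h4 2
    _ = _ := by rw [mul_pow, h5, h6]; ring

theorem IsState.exists_spectral {ρ : Matrix I I ℂ} (hρ : IsState ρ) :
    ∃ (l : I → ℝ) (u : I → EuclideanSpace ℂ I), (∀ i, 0 ≤ l i) ∧ ∑ i, l i = 1 ∧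
      (∀ i, ‖u i‖ = 1) ∧ ∀ Z : Matrix I I ℂ, (ρ * Z).trace.re =
        ∑ i, l i * (inner ℂ (u i) (toEuclideanCLM (n := I) (𝕜 := ℂ) Z (u i))).re := by
  have key : ∀ Z : Matrix I I ℂ, (ρ * Z).trace.re = ∑ i, hρ.1.1.eigenvalues i *
      (inner ℂ (hρ.1.1.eigenvectorBasis i)
        (toEuclideanCLM (n := I) (𝕜 := ℂ) Z (hρ.1.1.eigenvectorBasis i))).re := fun Z => by
    rw [trace_mul_comm, trace_eq_sum_inner _ hρ.1.1.eigenvectorBasis, Complex.re_sum]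
    refine Finset.sum_congr rfl fun i _ => ?_
    rw [map_mul, mul_apply_eq_comp, toEuclideanCLM_eigenvectorBasis, map_smul,
      inner_smul_right, Complex.re_ofReal_mul]
  refine ⟨_, _, hρ.1.eigenvalues_nonneg, ?_, hρ.1.1.eigenvectorBasis.orthonormal.1, key⟩
  have h := key 1
  simp only [mul_one, hρ.2, map_one, one_apply_eq_self, inner_self_eq_norm_sq_to_K,
    hρ.1.1.eigenvectorBasis.orthonormal.1] at h
  simpa using h.symm

theorem re_trace_sub_inner_sq_le {ρ B : Matrix I I ℂ} (hρ : IsState ρ) (hB : IsContraction B)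
    (hH : Bᴴ = B) {w : EuclideanSpace ℂ I} (hw : ‖w‖ = 1) :
    ((ρ * B).trace.re - (inner ℂ w (toEuclideanCLM (n := I) (𝕜 := ℂ) B w)).re) ^ 2
      ≤ 4 * (1 - (inner ℂ w (toEuclideanCLM (n := I) (𝕜 := ℂ) ρ w)).re) := by
  obtain ⟨l, u, hl, hl1, hu, key⟩ := hρ.exists_spectral
  have h1 : (inner ℂ w (toEuclideanCLM (n := I) (𝕜 := ℂ) ρ w)).re
      = ∑ i, l i * ‖inner ℂ (u i) w‖ ^ 2 := by
    have h2 : inner ℂ w (toEuclideanCLM (n := I) (𝕜 := ℂ) ρ w)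
        = (ρ * vecMulVec w.ofLp (star w.ofLp)).trace := by
      rw [EuclideanSpace.inner_eq_star_dotProduct, ofLp_toEuclideanCLM, mul_vecMulVec,
        trace_vecMulVec]
    rw [h2, key]
    refine Finset.sum_congr rfl fun i _ => ?_
    congr 1
    have h3 : toEuclideanCLM (n := I) (𝕜 := ℂ) (vecMulVec w.ofLp (star w.ofLp)) (u i)
        = inner ℂ w (u i) • w := by
      apply (WithLp.ofLp_injective 2)
      rw [ofLp_toEuclideanCLM, vecMulVec_mulVec, EuclideanSpace.inner_eq_star_dotProduct,
        dotProduct_comm]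
      ext j
      simp [mul_comm]
    rw [h3, inner_smul_right, ← inner_conj_symm w (u i), Complex.conj_mul', ← Complex.ofReal_pow,
      Complex.ofReal_re]
  rw [key, h1]
  exact sub_sq_le_of_average hl hl1 fun i => re_inner_sub_sq_le hB hH (hu i) hw

/-- The overlap tr(ρσ) is bilinear, so the pure-state bound averages over the two spectral
decompositions, one state at a time. -/
theorem re_trace_sub_sq_le {ρ σ B : Matrix I I ℂ} (hρ : IsState ρ) (hσ : IsState σ)
    (hB : IsContraction B) (hH : Bᴴ = B) :
    ((ρ * B).trace.re - (σ * B).trace.re) ^ 2 ≤ 4 * (1 - (ρ * σ).trace.re) := by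
  obtain ⟨l, u, hl, hl1, hu, key⟩ := hρ.exists_spectral
  rw [key, key]
  refine sub_sq_le_of_average hl hl1 fun i => ?_
  rw [sub_sq_comm]
  exact re_trace_sub_inner_sq_le hσ hB hH (hu i)

theorem IsState.purity_le_one {ρ : Matrix I I ℂ} (hρ : IsState ρ) : (ρ * ρ).trace.re ≤ 1 := by
  -- With B = 0 the left side vanishes, leaving 0 ≤ 4(1 - tr ρ²).
  have h := re_trace_sub_sq_le (B := 0) hρ hρ (by simpa [IsContraction] using PosSemidef.one)
    conjTranspose_zero
  simp only [sub_self] at h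
  linarith

/-- Hilbert–Schmidt Cauchy–Schwarz: ‖X - cYᴴ‖² is a nonnegative quadratic in c, so its discriminant
is nonpositive. -/
theorem re_trace_mul_sq_le (X Y : Matrix I I ℂ) {r : ℝ} (hr : (Yᴴ * Y).trace.re ≤ r) :
    (X * Y).trace.re ^ 2 ≤ r * (X * Xᴴ).trace.re := by
  have h : ∀ c : ℝ, 0 ≤ r * (c * c) + (-2 * (X * Y).trace.re) * c + (X * Xᴴ).trace.re := by
    intro c
    have h1 := (Complex.le_def.1
      (posSemidef_self_mul_conjTranspose (X - (c : ℂ) • Yᴴ)).trace_nonneg).1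
    have h2 : (Yᴴ * Xᴴ).trace.re = (X * Y).trace.re := by
      rw [← conjTranspose_mul, trace_conjTranspose, Complex.star_def, Complex.conj_re]
    rw [conjTranspose_sub, conjTranspose_smul, conjTranspose_conjTranspose, sub_mul, mul_sub,
      mul_sub, smul_mul_smul_comm, smul_mul_assoc, mul_smul_comm] at h1
    simp only [trace_sub, trace_smul, Complex.sub_re, smul_eq_mul, Complex.star_def,
      Complex.conj_ofReal, ← Complex.ofReal_mul, Complex.re_ofReal_mul, h2, Complex.zero_re] at h1
    nlinarith [mul_le_mul_of_nonneg_left hr (mul_self_nonneg c)]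
  have h3 := discrim_le_zero h
  rw [discrim] at h3
  nlinarith

theorem exists_support_projection {ρ : Matrix I I ℂ} (hρ : ρ.IsHermitian) :
    ∃ P : Matrix I I ℂ, Pᴴ = P ∧ P * P = P ∧ ρ * P = ρ ∧ P.trace = ρ.rank := by
  set U : Matrix I I ℂ := hρ.eigenvectorUnitary.1
  have hU : Uᴴ * U = 1 := Unitary.coe_star_mul_self hρ.eigenvectorUnitary
  set D : Matrix I I ℂ := diagonal fun i => if hρ.eigenvalues i = 0 then 0 else 1
  have hρU : ρ = U * diagonal (fun i => (hρ.eigenvalues i : ℂ)) * Uᴴ := hρ.spectral_theorem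
  have hDD : D * D = D := by
    rw [diagonal_mul_diagonal]
    congr 1; funext i; split_ifs <;> simp
  have hmul : ∀ A B : Matrix I I ℂ, U * A * Uᴴ * (U * B * Uᴴ) = U * (A * B) * Uᴴ := by
    intro A B
    calc _ = U * A * (Uᴴ * U) * B * Uᴴ := by simp only [mul_assoc]
      _ = _ := by rw [hU]; simp only [mul_assoc, one_mul]
  refine ⟨U * D * Uᴴ, ?_, by rw [hmul, hDD], ?_, ?_⟩
  · have : Dᴴ = D := by
      rw [diagonal_conjTranspose]; congr 1; funext i; simp [apply_ite]
    rw [conjTranspose_mul, conjTranspose_mul, conjTranspose_conjTranspose, this, mul_assoc]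
  · conv_lhs => rw [hρU]
    conv_rhs => rw [hρU]
    rw [hmul, diagonal_mul_diagonal]
    congr 3; funext i; split_ifs with h <;> simp [h]
  · rw [trace_mul_comm, ← mul_assoc, hU, one_mul, trace_diagonal,
      hρ.rank_eq_card_non_zero_eigs, Fintype.card_subtype]
    simp [Finset.sum_ite]

/-- A finite convex decomposition of a state into states. -/
def IsDecomposition {N : ℕ} (p : Fin N → ℝ) (ρt : Fin N → Matrix I I ℂ) (ρ : Matrix I I ℂ) :
    Prop :=
  (∀ t, 0 ≤ p t) ∧ ∑ t, p t = 1 ∧ (∀ t, IsState (ρt t)) ∧ ρ = ∑ t, (p t : ℂ) • ρt t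

variable {N : ℕ} {p : Fin N → ℝ} {ρt : Fin N → Matrix I I ℂ} {ρ : Matrix I I ℂ}

theorem IsDecomposition.re_trace_mul (h : IsDecomposition p ρt ρ) (Z : Matrix I I ℂ) :
    ∑ t, p t * (ρt t * Z).trace.re = (ρ * Z).trace.re := by
  rw [h.2.2.2, Finset.sum_mul, trace_sum, Complex.re_sum]
  refine Finset.sum_congr rfl fun t _ => ?_
  rw [smul_mul_assoc, trace_smul, smul_eq_mul, Complex.re_ofReal_mul]

/-- The nonnegative numbers p_s tr((1 - P)ρ_s(1 - P)) sum to zero because ρ(1 - P) = 0. Writing ρ_t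
= GGᴴ then forces (1 - P)G = 0. -/
theorem IsDecomposition.mul_support (h : IsDecomposition p ρt ρ) {P : Matrix I I ℂ}
    (hP : Pᴴ = P) (hρP : ρ * P = ρ) {t : Fin N} (ht : p t ≠ 0) : P * ρt t = ρt t := by
  have hQ : (1 - P)ᴴ = 1 - P := by rw [conjTranspose_sub, conjTranspose_one, hP]
  have h0 : ∀ s, 0 ≤ ((1 - P) * ρt s * (1 - P)).trace := fun s => by
    have := ((h.2.2.1 s).1.mul_mul_conjTranspose_same (1 - P)).trace_nonneg
    rwa [hQ] at this
  have h1 : ∑ s, p s * ((1 - P) * ρt s * (1 - P)).trace.re = 0 := by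
    have h2 := h.re_trace_mul ((1 - P) * (1 - P))
    rw [← mul_assoc, mul_sub ρ, hρP, mul_one, sub_self, zero_mul, trace_zero,
      Complex.zero_re] at h2
    rw [← h2]
    refine Finset.sum_congr rfl fun s _ => ?_
    rw [mul_assoc, trace_mul_comm, mul_assoc]
  have h2 := (Finset.sum_eq_zero_iff_of_nonneg fun s _ =>
    mul_nonneg (h.1 s) (Complex.le_def.1 (h0 s)).1).1 h1 t (Finset.mem_univ t)
  have h3 : ((1 - P) * ρt t * (1 - P)).trace = 0 :=
    Complex.ext ((mul_eq_zero.1 h2).resolve_left ht) (Complex.le_def.1 (h0 t)).2.symm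
  obtain ⟨G, hG⟩ := exists_eq_mul_conjTranspose (h.2.2.1 t).1
  have h4 : ((1 - P) * G) * ((1 - P) * G)ᴴ = (1 - P) * ρt t * (1 - P) := by
    rw [conjTranspose_mul, hQ, hG]; simp only [mul_assoc]
  rw [← h4, trace_mul_conjTranspose_self_eq_zero_iff] at h3
  have h5 : (1 - P) * ρt t = 0 := by rw [hG, ← mul_assoc, h3, zero_mul]
  rw [sub_mul, one_mul, sub_eq_zero] at h5
  exact h5.symm

/-- Cauchy–Schwarz bounds each squared deviation by r‖ρ_t - ρ‖₂², and the average of ‖ρ_t - ρ‖₂² is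
∑ p_t tr ρ_t² - τ ≤ 1 - τ. -/
theorem IsDecomposition.variance_le_rank (h : IsDecomposition p ρt ρ) (hρ : IsState ρ)
    {B : Matrix I I ℂ} (hB : IsContraction B) :
    ∑ t, p t * ((ρt t * B).trace.re - (ρ * B).trace.re) ^ 2
      ≤ ρ.rank * (1 - (ρ * ρ).trace.re) := by
  obtain ⟨P, hP, hPP, hρP, hr⟩ := exists_support_projection hρ.1.1
  have hPρ : P * ρ = ρ := by
    have := congrArg conjTranspose hρP
    rwa [conjTranspose_mul, hP, hρ.1.1] at this
  have hle : ((B * P)ᴴ * (B * P)).trace.re ≤ ρ.rank := by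
    have h1 := (Complex.le_def.1 (hB.conjTranspose_mul_mul_same P).trace_nonneg).1
    have h2 : Pᴴ * (1 - Bᴴ * B) * P = P - (B * P)ᴴ * (B * P) := by
      rw [conjTranspose_mul, hP, mul_sub, sub_mul, mul_one, hPP]
      simp only [mul_assoc]
    rw [h2, trace_sub, hr, Complex.sub_re, Complex.zero_re, Complex.natCast_re] at h1
    linarith
  have hH : ∀ t, (ρt t - ρ)ᴴ = ρt t - ρ := fun t => by
    rw [conjTranspose_sub, (h.2.2.1 t).1.1, hρ.1.1]
  have h1 : ∀ t, p t * ((ρt t * B).trace.re - (ρ * B).trace.re) ^ 2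
      ≤ ρ.rank * (p t * ((ρt t * ρt t).trace.re - 2 * (ρt t * ρ).trace.re
        + (ρ * ρ).trace.re)) := by
    intro t
    obtain ht | ht := eq_or_ne (p t) 0
    · simp [ht]
    -- Both states live on the support of ρ, so B may be replaced by BP, whose squared
    -- Hilbert–Schmidt norm is at most the rank instead of the dimension.
    have h2 := re_trace_mul_sq_le (ρt t - ρ) (B * P) hle
    have h3 : ((ρt t - ρ) * (B * P)).trace = (ρt t * B).trace - (ρ * B).trace := by
      rw [← mul_assoc, trace_mul_comm, ← mul_assoc, mul_sub, h.mul_support hP hρP ht, hPρ,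
        sub_mul, trace_sub]
    have h4 : ((ρt t - ρ) * (ρt t - ρ)ᴴ).trace
        = (ρt t * ρt t).trace - 2 * (ρt t * ρ).trace + (ρ * ρ).trace := by
      rw [hH, mul_sub, sub_mul, sub_mul]
      simp only [trace_sub]
      rw [trace_mul_comm ρ (ρt t)]
      ring
    rw [h3, h4] at h2
    simp only [Complex.sub_re, Complex.add_re, Complex.mul_re, Complex.re_ofNat, Complex.im_ofNat,
      zero_mul, sub_zero] at h2
    calc _ ≤ p t * _ := mul_le_mul_of_nonneg_left h2 (h.1 t)
      _ = _ := by ring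
  refine (Finset.sum_le_sum fun t _ => h1 t).trans ?_
  rw [← Finset.mul_sum]
  refine mul_le_mul_of_nonneg_left ?_ (Nat.cast_nonneg _)
  have h5 : ∀ t, p t * ((ρt t * ρt t).trace.re - 2 * (ρt t * ρ).trace.re + (ρ * ρ).trace.re)
      ≤ p t - 2 * (p t * (ρt t * ρ).trace.re) + p t * (ρ * ρ).trace.re := fun t => by
    have := mul_le_mul_of_nonneg_left (h.2.2.1 t).purity_le_one (h.1 t)
    linarith
  refine (Finset.sum_le_sum fun t _ => h5 t).trans ?_
  rw [Finset.sum_add_distrib, Finset.sum_sub_distrib, ← Finset.mul_sum, ← Finset.sum_mul,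
    h.2.1, h.re_trace_mul]
  linarith

theorem IsDecomposition.variance_le_purity (h : IsDecomposition p ρt ρ) (hρ : IsState ρ)
    {B : Matrix I I ℂ} (hB : IsObs B) :
    ∑ t, p t * ((ρt t * B).trace.re - (ρ * B).trace.re) ^ 2 ≤ 4 * (1 - (ρ * ρ).trace.re) := by
  refine (Finset.sum_le_sum fun t _ => mul_le_mul_of_nonneg_left
    (re_trace_sub_sq_le (h.2.2.1 t) hρ hB.isContraction hB.isHermitian) (h.1 t)).trans ?_
  have : ∀ t, p t * (4 * (1 - (ρt t * ρ).trace.re))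
      = 4 * p t - 4 * (p t * (ρt t * ρ).trace.re) := fun t => by ring
  simp only [this, Finset.sum_sub_distrib, ← Finset.mul_sum, h.2.1, h.re_trace_mul]
  linarith

theorem IsDecomposition.variance_le_one (h : IsDecomposition p ρt ρ)
    {B : Matrix I I ℂ} (hB : IsObs B) :
    ∑ t, p t * ((ρt t * B).trace.re - (ρ * B).trace.re) ^ 2 ≤ 1 := by
  rw [sum_mul_sub_sq h.2.1 (h.re_trace_mul B)]
  have : ∑ t, p t * (ρt t * B).trace.re ^ 2 ≤ ∑ t, p t * 1 :=
    Finset.sum_le_sum fun t _ => mul_le_mul_of_nonneg_left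
      ((sq_le_one_iff_abs_le_one _).2 (abs_re_trace_mul_obs_le (h.2.2.1 t) hB)) (h.1 t)
  simp only [mul_one, h.2.1] at this
  linarith [sq_nonneg (ρ * B).trace.re]

theorem IsDecomposition.variance_le_beta (h : IsDecomposition p ρt ρ) (hρ : IsState ρ)
    {B : Matrix I I ℂ} (hB : IsObs B) :
    ∑ t, p t * ((ρt t * B).trace.re - (ρ * B).trace.re) ^ 2 ≤ beta ρ := by
  refine le_min (h.variance_le_rank hρ hB.isContraction) ?_
  have h1 := h.variance_le_purity hρ hB
  have h2 := h.variance_le_one hB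
  have h3 := re_trace_mul_nonneg hρ.1 hρ.1
  have h4 := hρ.purity_le_one
  set τ := (ρ * ρ).trace.re
  -- 4(1 - τ) ≤ 2√(1 - τ²) holds exactly from τ = 3/5 up to 1; below 3/5 the trivial variance bound
  -- 1 is enough.
  obtain hτ | hτ := le_total τ (3 / 5)
  · refine h2.trans ?_
    have : (1 / 2 : ℝ) ≤ Real.sqrt (1 - τ ^ 2) := Real.le_sqrt_of_sq_le (by nlinarith)
    linarith
  · refine h1.trans ?_
    have : 2 * (1 - τ) ≤ Real.sqrt (1 - τ ^ 2) := Real.le_sqrt_of_sq_le (by nlinarith)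
    linarith

end Variance

/-! ### Telescoping over commuting projections -/

section Projections

theorem norm_sq_sub_norm_sq_apply {F : Type*} [NormedAddCommGroup F] [InnerProductSpace ℂ F]
    {p : F →ₗ[ℂ] F} (hp : p.IsSymmetric) (hpp : ∀ x, p (p x) = p x) (y : F) :
    ‖y‖ ^ 2 - ‖p y‖ ^ 2 = ‖y - p y‖ ^ 2 := by
  have h : inner ℂ y (p y) = inner ℂ (p y) (p y) := by rw [hp, hpp]
  rw [norm_sub_sq (𝕜 := ℂ), h, inner_self_eq_norm_sq]
  ring

/-- Adding e to s lowers ‖P s y‖² by the squared norm of an increment. For y = ∑ x v only the at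
most k vectors with v ∈ inc e contribute, and Cauchy–Schwarz compares the square of their sum with k
times the sum of their squares. -/
theorem norm_sq_sub_le_of_projections {F V ε : Type*} [NormedAddCommGroup F]
    [InnerProductSpace ℂ F] [Fintype V] [DecidableEq ε] {k : ℕ}
    (P : Finset ε → F →ₗ[ℂ] F) (hsymm : ∀ s, (P s).IsSymmetric)
    (hunion : ∀ s t x, P s (P t x) = P (s ∪ t) x) (hempty : ∀ x, P ∅ x = x)
    (inc : ε → Finset V) (hinc : ∀ e, (inc e).card ≤ k) (x : V → F)
    (hx : ∀ e v, v ∉ inc e → P {e} (x v) = x v) (s : Finset ε) :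
    ‖∑ v, x v‖ ^ 2 - ‖P s (∑ v, x v)‖ ^ 2 ≤ k * ∑ v, (‖x v‖ ^ 2 - ‖P s (x v)‖ ^ 2) := by
  classical
  induction s using Finset.induction_on with
  | empty => simp [hempty]
  | insert e s _ ih =>
    have hins : ∀ y, P (insert e s) y = P {e} (P s y) := fun y => by
      rw [hunion, Finset.insert_eq]
    have hstep : ∀ y, ‖P s y‖ ^ 2 - ‖P (insert e s) y‖ ^ 2 = ‖P s y - P {e} (P s y)‖ ^ 2 :=
      fun y => by
        rw [hins]
        exact norm_sq_sub_norm_sq_apply (hsymm _) (fun x => by rw [hunion, Finset.union_self]) _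
    set d : V → F := fun v => P s (x v) - P {e} (P s (x v)) with hd
    have hd0 : ∀ v, v ∉ inc e → d v = 0 := fun v hv => by
      rw [hd]
      simp only
      -- The union law makes the projections commute, so `P {e}` can be moved onto `x v`, which it
      -- fixes.
      rw [hunion, Finset.union_comm, ← hunion, hx e v hv, sub_self]
    have hsum : P s (∑ v, x v) - P {e} (P s (∑ v, x v)) = ∑ v ∈ inc e, d v := by
      rw [map_sum, map_sum, ← Finset.sum_sub_distrib]
      exact (Finset.sum_subset (Finset.subset_univ _) fun v _ hv => hd0 v hv).symm
    have h1 : ‖∑ v ∈ inc e, d v‖ ^ 2 ≤ k * ∑ v, ‖d v‖ ^ 2 :=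
      calc ‖∑ v ∈ inc e, d v‖ ^ 2 ≤ (∑ v ∈ inc e, ‖d v‖) ^ 2 :=
            pow_le_pow_left₀ (norm_nonneg _) (norm_sum_le _ _) 2
        _ ≤ (inc e).card * ∑ v ∈ inc e, ‖d v‖ ^ 2 := sq_sum_le_card_mul_sum_sq
        _ ≤ k * ∑ v, ‖d v‖ ^ 2 := mul_le_mul (by exact_mod_cast hinc e)
            (Finset.sum_le_sum_of_subset_of_nonneg (Finset.subset_univ _)
              fun _ _ _ => sq_nonneg _)
            (Finset.sum_nonneg fun _ _ => sq_nonneg _) (Nat.cast_nonneg _)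
    have h2 := hstep (∑ v, x v)
    rw [hsum] at h2
    have h3 : ∑ v, (‖x v‖ ^ 2 - ‖P (insert e s) (x v)‖ ^ 2)
        = ∑ v, (‖x v‖ ^ 2 - ‖P s (x v)‖ ^ 2) + ∑ v, ‖d v‖ ^ 2 := by
      rw [← Finset.sum_add_distrib]
      exact Finset.sum_congr rfl fun v _ => by rw [← hstep]; ring
    rw [h3, mul_add]
    linarith

end Projections

/-! ### Product vectors and operators ignoring a tensor factor -/

section ProductVector

variable {ε : Type*} [Fintype ε] [DecidableEq ε] {J : ε → Type*} [∀ e, Fintype (J e)]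
  [∀ e, DecidableEq (J e)]

/-- `X` acts as the identity on the tensor factor `e`. -/
def ActsTrivially (e : ε) (X : Matrix (∀ e, J e) (∀ e, J e) ℂ) : Prop :=
  (∀ x y, x e ≠ y e → X x y = 0) ∧
    ∀ x y a, x e = y e → X (Function.update x e a) (Function.update y e a) = X x y

omit [∀ e, Fintype (J e)] in
theorem localOp_update_left (e : ε) (Q : Matrix (J e) (J e) ℂ) (x : ∀ e, J e) (a : J e) :
    localOp e Q x (Function.update x e a) = Q (x e) a := by
  rw [localOp_apply, Function.update_self, if_pos, mul_one]
  exact fun w hw => (Function.update_of_ne hw _ _).symm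

omit [∀ e, Fintype (J e)] in
theorem localOp_eq_zero (e : ε) (Q : Matrix (J e) (J e) ℂ) {x z : ∀ e, J e}
    (h : z ∉ Set.range (Function.update x e)) : localOp e Q x z = 0 := by
  rw [localOp_apply, if_neg, mul_zero]
  refine fun hxz => h ⟨z e, ?_⟩
  funext w
  by_cases hw : w = e
  · subst hw; simp
  · rw [Function.update_of_ne hw, hxz w hw]

theorem localOp_mul_apply (e : ε) (Q : Matrix (J e) (J e) ℂ)
    (X : Matrix (∀ e, J e) (∀ e, J e) ℂ) (x y : ∀ e, J e) :
    (localOp e Q * X) x y = ∑ a, Q (x e) a * X (Function.update x e a) y := by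
  rw [mul_apply]
  refine (Fintype.sum_of_injective (Function.update x e) (Function.update_injective x e) _ _
    (fun z hz => by rw [localOp_eq_zero e Q hz, zero_mul]) fun a => ?_).symm
  rw [localOp_update_left]

theorem mul_localOp_apply (e : ε) (Q : Matrix (J e) (J e) ℂ)
    (X : Matrix (∀ e, J e) (∀ e, J e) ℂ) (x y : ∀ e, J e) :
    (X * localOp e Q) x y = ∑ a, X x (Function.update y e a) * Q a (y e) := by
  have h : X * localOp e Q = (localOp e Qᴴ * Xᴴ)ᴴ := by
    rw [conjTranspose_mul, localOp_conjTranspose, conjTranspose_conjTranspose,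
      conjTranspose_conjTranspose]
  rw [h, conjTranspose_apply, localOp_mul_apply, star_sum]
  refine Finset.sum_congr rfl fun a _ => ?_
  rw [star_mul', conjTranspose_apply, conjTranspose_apply, star_star, star_star, mul_comm]

theorem ActsTrivially.commute {e : ε} {X : Matrix (∀ e, J e) (∀ e, J e) ℂ}
    (hX : ActsTrivially e X) (Q : Matrix (J e) (J e) ℂ) :
    localOp e Q * X = X * localOp e Q := by
  ext x y
  rw [localOp_mul_apply, mul_localOp_apply, Fintype.sum_eq_single (y e),
    Fintype.sum_eq_single (x e)]
  · have h := hX.2 (Function.update x e (y e)) y (x e) (by simp)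
    rw [← h, Function.update_idem, Function.update_eq_self, mul_comm]
  · intro a ha
    rw [hX.1 _ _ (by simpa using ha.symm), zero_mul]
  · intro a ha
    rw [hX.1 _ _ (by simpa using ha), mul_zero]

variable (φ : ∀ e, J e → ℂ)

/-- The product vector `⨂ e, φ e`. -/
def productVec : (∀ e, J e) → ℂ := fun x => ∏ e, φ e (x e)

/-- The projection onto the vectors `φ e` in the tensor factors `e ∈ s`. -/
def partialProj (s : Finset ε) : Matrix (∀ e, J e) (∀ e, J e) ℂ :=
  tensorOp fun e => if e ∈ s then vecMulVec (φ e) (star (φ e)) else 1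

omit [∀ e, Fintype (J e)] in
theorem partialProj_empty : partialProj φ ∅ = 1 := by
  simp only [partialProj, Finset.notMem_empty, if_false, tensorOp_one]

omit [∀ e, Fintype (J e)] in
theorem partialProj_conjTranspose (s : Finset ε) : (partialProj φ s)ᴴ = partialProj φ s := by
  rw [partialProj, tensorOp_conjTranspose]
  congr 1
  funext e
  split_ifs
  · rw [conjTranspose_vecMulVec, star_star]
  · exact conjTranspose_one

omit [∀ e, Fintype (J e)] in
theorem partialProj_singleton (e : ε) :
    partialProj φ {e} = localOp e (vecMulVec (φ e) (star (φ e))) := by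
  rw [partialProj, localOp]
  congr 1
  funext w
  by_cases h : w = e
  · subst h; simp
  · simp [h]

omit [∀ e, Fintype (J e)] in
theorem partialProj_univ :
    partialProj φ Finset.univ = vecMulVec (productVec φ) (star (productVec φ)) := by
  ext x y
  simp [partialProj, tensorOp_apply, vecMulVec_apply, productVec, Finset.prod_mul_distrib]

variable {φ} (hφ : ∀ e, star (φ e) ⬝ᵥ φ e = 1)

include hφ

theorem partialProj_mul (s t : Finset ε) :
    partialProj φ s * partialProj φ t = partialProj φ (s ∪ t) := by
  rw [partialProj, partialProj, tensorOp_mul, partialProj]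
  congr 1
  funext e
  by_cases hs : e ∈ s <;> by_cases ht : e ∈ t <;>
    simp [hs, ht, vecMulVec_mul_vecMulVec, hφ]

omit [∀ e, DecidableEq (J e)] in
theorem productVec_norm : star (productVec φ) ⬝ᵥ productVec φ = 1 := by
  have h : star (productVec φ) ⬝ᵥ productVec φ = ∏ e, star (φ e) ⬝ᵥ φ e := by
    simp only [dotProduct, Finset.prod_univ_sum, Fintype.piFinset_univ]
    refine Finset.sum_congr rfl fun x _ => ?_
    simp [productVec, Finset.prod_mul_distrib]
  rw [h, Finset.prod_congr rfl fun e _ => hφ e, Finset.prod_const_one]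

/-- An operator trivial on e commutes with the projection onto φ e, which fixes ψ; hence it also
fixes X_v ψ. Projecting all factors gives |ψ⟩⟨ψ|, which turns the telescoping bound into one about
variances. -/
theorem norm_sq_sub_le_of_actsTrivially {V : Type*} [Fintype V] {k : ℕ} (inc : ε → Finset V)
    (hinc : ∀ e, (inc e).card ≤ k) (X : V → Matrix (∀ e, J e) (∀ e, J e) ℂ)
    (hX : ∀ e v, v ∉ inc e → ActsTrivially e (X v)) {ψ : EuclideanSpace ℂ (∀ e, J e)}
    (hψ : ψ.ofLp = productVec φ) :
    ‖∑ v, toEuclideanCLM (𝕜 := ℂ) (X v) ψ‖ ^ 2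
        - ‖∑ v, inner ℂ ψ (toEuclideanCLM (𝕜 := ℂ) (X v) ψ)‖ ^ 2
      ≤ k * ∑ v, (‖toEuclideanCLM (𝕜 := ℂ) (X v) ψ‖ ^ 2
        - ‖inner ℂ ψ (toEuclideanCLM (𝕜 := ℂ) (X v) ψ)‖ ^ 2) := by
  have hnorm : ‖ψ‖ = 1 := by
    have h := productVec_norm hφ
    rw [← hψ, dotProduct_comm, ← EuclideanSpace.inner_eq_star_dotProduct] at h
    have h2 := inner_self_eq_norm_sq (𝕜 := ℂ) ψ
    rw [h, RCLike.one_re] at h2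
    exact (pow_eq_one_iff_of_nonneg (norm_nonneg _) two_ne_zero).1 h2.symm
  have huniv : ∀ y, toEuclideanCLM (𝕜 := ℂ) (partialProj φ Finset.univ) y = inner ℂ ψ y • ψ := by
    intro y
    apply (WithLp.ofLp_injective 2)
    rw [ofLp_toEuclideanCLM, partialProj_univ, vecMulVec_mulVec,
      EuclideanSpace.inner_eq_star_dotProduct, dotProduct_comm, ← hψ]
    ext j
    simp [mul_comm]
  have hunion : ∀ s t y, toEuclideanCLM (𝕜 := ℂ) (partialProj φ s)
      (toEuclideanCLM (𝕜 := ℂ) (partialProj φ t) y)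
      = toEuclideanCLM (𝕜 := ℂ) (partialProj φ (s ∪ t)) y := fun s t y => by
    rw [← partialProj_mul hφ, map_mul, mul_apply_eq_comp]
  have hψuniv : toEuclideanCLM (𝕜 := ℂ) (partialProj φ Finset.univ) ψ = ψ := by
    rw [huniv, inner_self_eq_norm_sq_to_K, hnorm]; simp
  have hψ1 : ∀ s, toEuclideanCLM (𝕜 := ℂ) (partialProj φ s) ψ = ψ := fun s => by
    conv_lhs => rw [← hψuniv, hunion, Finset.union_eq_right.2 (Finset.subset_univ s), hψuniv]
  have key := norm_sq_sub_le_of_projections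
    (fun s => (toEuclideanCLM (𝕜 := ℂ) (partialProj φ s)).toLinearMap)
    (fun s x y => by
      change inner ℂ (toEuclideanCLM (𝕜 := ℂ) (partialProj φ s) x) y
        = inner ℂ x (toEuclideanCLM (𝕜 := ℂ) (partialProj φ s) y)
      rw [← ContinuousLinearMap.adjoint_inner_right, ← ContinuousLinearMap.star_eq_adjoint,
        ← map_star, star_eq_conjTranspose, partialProj_conjTranspose])
    hunion (fun x => by
      change toEuclideanCLM (𝕜 := ℂ) (partialProj φ ∅) x = x
      rw [partialProj_empty, map_one, one_apply_eq_self]) inc hinc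
    (fun v => toEuclideanCLM (𝕜 := ℂ) (X v) ψ)
    (fun e v hv => by
      change toEuclideanCLM (𝕜 := ℂ) (partialProj φ {e}) (toEuclideanCLM (𝕜 := ℂ) (X v) ψ) = _
      rw [← mul_apply_eq_comp, ← map_mul, partialProj_singleton, (hX e v hv).commute,
        ← partialProj_singleton, map_mul, mul_apply_eq_comp, hψ1]) Finset.univ
  have hn : ∀ y, ‖toEuclideanCLM (𝕜 := ℂ) (partialProj φ Finset.univ) y‖ = ‖inner ℂ ψ y‖ :=
    fun y => by rw [huniv, norm_smul, hnorm, mul_one]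
  simpa only [ContinuousLinearMap.coe_coe, hn, inner_sum] using key

end ProductVector

/-! ### Purification of the sources -/

section Purification

variable {ε : Type*} {I : ε → Type*}

/-- Separating the two copies in a product of doubled systems. -/
abbrev doubleEquiv : (∀ e, I e × I e) ≃ (∀ e, I e) × (∀ e, I e) :=
  Equiv.arrowProdEquivProdArrow ε I I

variable [Fintype ε] [DecidableEq ε] [∀ e, Fintype (I e)] [∀ e, DecidableEq (I e)]

/-- The operator `X ⊗ 1` on the doubled system. -/
def double (X : Matrix (∀ e, I e) (∀ e, I e) ℂ) :
    Matrix (∀ e, I e × I e) (∀ e, I e × I e) ℂ :=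
  Matrix.of fun x y => X (doubleEquiv x).1 (doubleEquiv y).1 *
    if (doubleEquiv x).2 = (doubleEquiv y).2 then 1 else 0

omit [∀ e, Fintype (I e)] in
theorem ActsTrivially.double {e : ε} {X : Matrix (∀ e, I e) (∀ e, I e) ℂ}
    (hX : ActsTrivially e X) : ActsTrivially e (double X) := by
  have hup : ∀ (x : ∀ e, I e × I e) (a : I e × I e), doubleEquiv (Function.update x e a)
      = (Function.update (doubleEquiv x).1 e a.1, Function.update (doubleEquiv x).2 e a.2) := by
    intro x a
    ext w <;> by_cases h : w = e
    · subst h; simp [doubleEquiv]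
    · simp [doubleEquiv, h]
    · subst h; simp [doubleEquiv]
    · simp [doubleEquiv, h]
  refine ⟨fun x y h => ?_, fun x y a h => ?_⟩
  · simp only [QNet.double, of_apply]
    by_cases h1 : (x e).1 = (y e).1
    · rw [if_neg, mul_zero]
      exact fun h2 => h (Prod.ext h1 (congrFun h2 e))
    · rw [hX.1 _ _ h1, zero_mul]
  · simp only [QNet.double, of_apply, hup]
    rw [hX.2 _ _ _ (congrArg Prod.fst h)]
    congr 1
    refine if_congr ⟨fun h2 => ?_, fun h2 => by rw [h2]⟩ rfl rfl
    funext w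
    by_cases hw : w = e
    · subst hw; exact congrArg Prod.snd h
    · simpa [hw] using congrFun h2 w

omit [∀ e, DecidableEq (I e)] in
theorem sum_doubleEquiv (f : (∀ e, I e) → (∀ e, I e) → ℂ) :
    ∑ x : ∀ e, I e × I e, f (doubleEquiv x).1 (doubleEquiv x).2 = ∑ a, ∑ b, f a b := by
  rw [← Fintype.sum_prod_type' f]
  exact Equiv.sum_comp doubleEquiv fun p : (∀ e, I e) × (∀ e, I e) => f p.1 p.2

/-- A vector of the doubled system is read as a matrix; X ⊗ 1 is then left multiplication. -/
theorem double_mulVec (X G : Matrix (∀ e, I e) (∀ e, I e) ℂ) :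
    double X *ᵥ (fun x => G (doubleEquiv x).1 (doubleEquiv x).2)
      = fun x => (X * G) (doubleEquiv x).1 (doubleEquiv x).2 := by
  funext x
  simp only [mulVec, dotProduct, double, of_apply]
  rw [sum_doubleEquiv fun a b => X (doubleEquiv x).1 a *
    (if (doubleEquiv x).2 = b then 1 else 0) * G a b, mul_apply]
  simp

omit [∀ e, DecidableEq (I e)] in
theorem inner_double (A B : Matrix (∀ e, I e) (∀ e, I e) ℂ)
    {x y : EuclideanSpace ℂ (∀ e, I e × I e)}
    (hx : x.ofLp = fun z => A (doubleEquiv z).1 (doubleEquiv z).2)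
    (hy : y.ofLp = fun z => B (doubleEquiv z).1 (doubleEquiv z).2) :
    inner ℂ x y = (Aᴴ * B).trace := by
  rw [EuclideanSpace.inner_eq_star_dotProduct, hx, hy]
  refine (sum_doubleEquiv fun a b => B a b * star (A a b)).trans ?_
  rw [Finset.sum_comm]
  simp only [trace, diag_apply, mul_apply, conjTranspose_apply, mul_comm]

theorem product_covariance_le {V : Type*} [Fintype V] {k : ℕ}
    {γ : ∀ e, Matrix (I e) (I e) ℂ} (hγ : ∀ e, IsState (γ e)) (inc : ε → Finset V)
    (hinc : ∀ e, (inc e).card ≤ k) (X : V → Matrix (∀ e, I e) (∀ e, I e) ℂ)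
    (hH : ∀ v, (X v)ᴴ = X v) (hX : ∀ e v, v ∉ inc e → ActsTrivially e (X v)) :
    ∑ i, ∑ j, ((tensorOp γ * (X i * X j)).trace.re
        - (tensorOp γ * X i).trace.re * (tensorOp γ * X j).trace.re)
      ≤ k * ∑ i, ((tensorOp γ * (X i * X i)).trace.re
        - (tensorOp γ * X i).trace.re * (tensorOp γ * X i).trace.re) := by
  choose g hg using fun e => exists_eq_mul_conjTranspose (hγ e).1
  set G := tensorOp g
  have hG : tensorOp γ = G * Gᴴ := by
    rw [tensorOp_conjTranspose, tensorOp_mul]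
    exact congrArg tensorOp (funext hg)
  -- With γ_e = g_e g_eᴴ, the matrix g_e read as a vector purifies γ_e; its squared norm is tr γ_e =
  -- 1.
  set φ : ∀ e, I e × I e → ℂ := fun e p => g e p.1 p.2 with hφdef
  have hφ : ∀ e, star (φ e) ⬝ᵥ φ e = 1 := fun e => by
    rw [← (hγ e).2, hg e]
    simp only [dotProduct, Fintype.sum_prod_type, trace, diag_apply, mul_apply,
      conjTranspose_apply, hφdef, Pi.star_apply, mul_comm]
  set ψ : EuclideanSpace ℂ (∀ e, I e × I e) := WithLp.toLp 2 (productVec φ) with hψ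
  have hψG : ψ.ofLp = fun z => G (doubleEquiv z).1 (doubleEquiv z).2 := rfl
  have hXψ : ∀ v, (toEuclideanCLM (𝕜 := ℂ) (double (X v)) ψ).ofLp
      = fun z => (X v * G) (doubleEquiv z).1 (doubleEquiv z).2 := fun v => by
    rw [ofLp_toEuclideanCLM, hψG, double_mulVec]
  have hin : ∀ i j, inner ℂ (toEuclideanCLM (𝕜 := ℂ) (double (X i)) ψ)
      (toEuclideanCLM (𝕜 := ℂ) (double (X j)) ψ) = (tensorOp γ * (X i * X j)).trace := by
    intro i j
    rw [inner_double _ _ (hXψ i) (hXψ j), hG, conjTranspose_mul, hH, mul_assoc, mul_assoc,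
      trace_mul_comm G, mul_assoc, mul_assoc]
  have hin1 : ∀ j, inner ℂ ψ (toEuclideanCLM (𝕜 := ℂ) (double (X j)) ψ)
      = ((tensorOp γ * X j).trace.re : ℂ) := by
    intro j
    have h1 : inner ℂ ψ (toEuclideanCLM (𝕜 := ℂ) (double (X j)) ψ)
        = (tensorOp γ * X j).trace := by
      rw [inner_double _ _ hψG (hXψ j), hG, mul_assoc, trace_mul_comm G, mul_assoc]
    rw [h1]
    refine (Complex.conj_eq_iff_re.1 ?_).symm
    rw [← Complex.star_def, ← trace_conjTranspose, conjTranspose_mul, hH, trace_mul_comm, hG,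
      conjTranspose_mul, conjTranspose_conjTranspose]
  have key := norm_sq_sub_le_of_actsTrivially hφ inc hinc (fun v => double (X v))
    (fun e v hv => (hX e v hv).double) (ψ := ψ) rfl
  have hsq : ∀ i, ‖toEuclideanCLM (𝕜 := ℂ) (double (X i)) ψ‖ ^ 2
      = (tensorOp γ * (X i * X i)).trace.re := fun i => by
    rw [← hin, ← inner_self_eq_norm_sq (𝕜 := ℂ)]; rfl
  have hsum : ‖∑ i, toEuclideanCLM (𝕜 := ℂ) (double (X i)) ψ‖ ^ 2
      = ∑ i, ∑ j, (tensorOp γ * (X i * X j)).trace.re := by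
    rw [← inner_self_eq_norm_sq (𝕜 := ℂ), sum_inner, map_sum]
    refine Finset.sum_congr rfl fun i _ => ?_
    rw [inner_sum, map_sum]
    exact Finset.sum_congr rfl fun j _ => by rw [hin]; rfl
  simp only [hin1, hsq, hsum, ← Complex.ofReal_sum, Complex.norm_real, Real.norm_eq_abs,
    sq_abs] at key
  simp only [Finset.sum_sub_distrib, ← Finset.sum_mul_sum, ← sq] at key ⊢
  exact key

end Purification

/-! ### Channels in the Heisenberg picture -/

section Channels

variable {K H : Type*} [Fintype K] [DecidableEq K] [Fintype H] [DecidableEq H] {m : ℕ}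

/-- The adjoint (Heisenberg picture) of the channel with Kraus operators `A i`. -/
def dualOp (A : Fin m → Matrix H K ℂ) (B : Matrix H H ℂ) : Matrix K K ℂ :=
  ∑ i, (A i)ᴴ * B * A i

omit [Fintype K] [DecidableEq K] [DecidableEq H] in
theorem dualOp_sub (A : Fin m → Matrix H K ℂ) (B C : Matrix H H ℂ) :
    dualOp A (B - C) = dualOp A B - dualOp A C := by
  simp only [dualOp, Matrix.mul_sub, Matrix.sub_mul, Finset.sum_sub_distrib]

omit [Fintype K] [DecidableEq K] [DecidableEq H] in
theorem dualOp_add (A : Fin m → Matrix H K ℂ) (B C : Matrix H H ℂ) :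
    dualOp A (B + C) = dualOp A B + dualOp A C := by
  simp only [dualOp, Matrix.mul_add, Matrix.add_mul, Finset.sum_add_distrib]

theorem dualOp_one {A : Fin m → Matrix H K ℂ} (hA : IsKraus A) :
    dualOp A 1 = 1 := by
  simp only [dualOp, Matrix.mul_one]
  exact hA

omit [DecidableEq K] [DecidableEq H] in
theorem dualOp_posSemidef (A : Fin m → Matrix H K ℂ) {B : Matrix H H ℂ} (hB : B.PosSemidef) :
    (dualOp A B).PosSemidef :=
  posSemidef_sum _ fun i _ => hB.conjTranspose_mul_mul_same (A i)

theorem IsObs.dualOp {A : Fin m → Matrix H K ℂ} (hA : IsKraus A) {B : Matrix H H ℂ}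
    (hB : IsObs B) : IsObs (dualOp A B) := by
  obtain ⟨P, Q, hP, hQ, h, rfl⟩ := hB
  exact ⟨_, _, dualOp_posSemidef A hP, dualOp_posSemidef A hQ,
    by rw [← dualOp_add, h, dualOp_one hA], dualOp_sub A P Q⟩

omit [DecidableEq H] in
/-- **Kadison–Schwarz inequality** for a channel in the Heisenberg picture. -/
theorem dualOp_mul_self_sub_posSemidef {A : Fin m → Matrix H K ℂ} (hA : IsKraus A)
    {B : Matrix H H ℂ} (hB : Bᴴ = B) :
    (dualOp A (B * B) - dualOp A B * dualOp A B).PosSemidef := by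
  set X := dualOp A B with hX
  have hXH : Xᴴ = X := by
    simp only [hX, dualOp, conjTranspose_sum, conjTranspose_mul, hB, conjTranspose_conjTranspose,
      Matrix.mul_assoc]
  -- An explicit sum of squares: by the Kraus condition the cross terms and the last term combine to
  -- -X².
  have h1 : ∑ i, (B * A i - A i * X)ᴴ * (B * A i - A i * X) = dualOp A (B * B) - X * X := by
    have h2 : ∀ i, (B * A i - A i * X)ᴴ * (B * A i - A i * X)
        = (A i)ᴴ * (B * B) * A i - ((A i)ᴴ * B * A i) * X - X * ((A i)ᴴ * B * A i)
          + X * ((A i)ᴴ * A i) * X := fun i => by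
      rw [conjTranspose_sub, conjTranspose_mul, conjTranspose_mul, hB, hXH]
      simp only [Matrix.sub_mul, Matrix.mul_sub, Matrix.mul_assoc]
      abel
    simp only [h2, Finset.sum_add_distrib, Finset.sum_sub_distrib, ← Finset.sum_mul,
      ← Finset.mul_sum]
    rw [show ∑ i, (A i)ᴴ * A i = 1 from hA, show ∑ i, (A i)ᴴ * B * A i = X from rfl, mul_one,
      show ∑ i, (A i)ᴴ * (B * B) * A i = dualOp A (B * B) from rfl]
    abel
  rw [← h1]
  exact posSemidef_sum _ fun i _ => posSemidef_conjTranspose_mul_self _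

end Channels

/-! ### Pulling ω back through local channels -/

section LocalChannels

variable {V : Type*} [Fintype V] [DecidableEq V] {K H : V → Type*} [∀ v, Fintype (K v)]
  [∀ v, DecidableEq (K v)] [∀ v, Fintype (H v)] [∀ v, DecidableEq (H v)] {m : V → ℕ}
  {A : ∀ v, Fin (m v) → Matrix (H v) (K v) ℂ}

omit [∀ v, DecidableEq (K v)] [∀ v, DecidableEq (H v)] in
theorem trace_applyLocal_mul_tensorOp (τ : Matrix (∀ v, K v) (∀ v, K v) ℂ)
    (b : ∀ v, Matrix (H v) (H v) ℂ) :
    (applyLocal A τ * tensorOp b).trace = (τ * tensorOp fun v => dualOp (A v) (b v)).trace := by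
  have h : tensorOp (fun v => dualOp (A v) (b v)) = ∑ i : ∀ v, Fin (m v),
      (tensorOp fun v => A v (i v))ᴴ * tensorOp b * tensorOp fun v => A v (i v) := by
    simp only [tensorOp_conjTranspose, tensorOp_mul]
    exact (sum_tensorOp fun v a => (A v a)ᴴ * b v * A v a).symm
  rw [h, applyLocal, Finset.sum_mul, Finset.mul_sum, trace_sum, trace_sum]
  refine Finset.sum_congr rfl fun i _ => ?_
  rw [Matrix.mul_assoc, Matrix.mul_assoc, trace_mul_comm]
  simp only [Matrix.mul_assoc]

variable (hA : ∀ v, IsKraus (A v))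

include hA

theorem trace_applyLocal_mul_localOp (τ : Matrix (∀ v, K v) (∀ v, K v) ℂ) (v : V)
    (B : Matrix (H v) (H v) ℂ) :
    (applyLocal A τ * localOp v B).trace = (τ * localOp v (dualOp (A v) B)).trace := by
  rw [localOp, trace_applyLocal_mul_tensorOp, localOp]
  congr 3
  funext w
  by_cases hw : w = v
  · subst hw; simp
  · simp [hw, dualOp_one (hA w)]

theorem trace_applyLocal_mul_localOp_mul {v w : V} (hvw : v ≠ w)
    (τ : Matrix (∀ v, K v) (∀ v, K v) ℂ) (B : Matrix (H v) (H v) ℂ) (C : Matrix (H w) (H w) ℂ) :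
    (applyLocal A τ * (localOp v B * localOp w C)).trace
      = (τ * (localOp v (dualOp (A v) B) * localOp w (dualOp (A w) C))).trace := by
  rw [localOp_mul_of_ne hvw, trace_applyLocal_mul_tensorOp, localOp_mul_of_ne hvw]
  congr 3
  funext u
  by_cases hw : u = w
  · subst hw; simp
  · by_cases hv : u = v
    · subst hv; simp [hw]
    · simp [hw, hv, dualOp_one (hA u)]

theorem IsState.applyLocal {τ : Matrix (∀ v, K v) (∀ v, K v) ℂ} (hτ : IsState τ) :
    IsState (applyLocal A τ) := by
  refine ⟨posSemidef_sum _ fun i _ => hτ.1.mul_mul_conjTranspose_same _, ?_⟩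
  have h := trace_applyLocal_mul_tensorOp (A := A) τ fun v => (1 : Matrix (H v) (H v) ℂ)
  simp only [dualOp_one (hA _), tensorOp_one, mul_one] at h
  rw [h, hτ.2]

/-- Covariances of distinct parties are preserved. By Kadison–Schwarz a pulled-back variance is at
most the original one, and it enters ω with weight -(k - 1) ≤ 0. -/
theorem omega_applyLocal_le {k : ℕ} (hk : 1 ≤ k) {M : ∀ v, Matrix (H v) (H v) ℂ}
    (hM : IsMeasurement M) {τ : Matrix (∀ v, K v) (∀ v, K v) ℂ} (hτ : τ.PosSemidef) :
    omega k M (applyLocal A τ) ≤ omega k (fun v => dualOp (A v) (M v)) τ := by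
  set M' : ∀ v, Matrix (K v) (K v) ℂ := fun v => dualOp (A v) (M v)
  have hoff : ∀ i j, i ≠ j → cov M (applyLocal A τ) i j = cov M' τ i j := fun i j hij => by
    simp only [cov, of_apply, trace_applyLocal_mul_localOp_mul hA hij,
      trace_applyLocal_mul_localOp hA, M']
  have hdiag : ∀ i, cov M' τ i i ≤ cov M (applyLocal A τ) i i := fun i => by
    simp only [cov, of_apply, trace_applyLocal_mul_localOp hA, localOp_mul, M']
    have h := re_trace_mul_nonneg hτ (localOp_posSemidef i
      (dualOp_mul_self_sub_posSemidef (hA i) (IsObs.isHermitian (hM i))))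
    rw [localOp_sub, mul_sub, trace_sub, Complex.sub_re] at h
    linarith
  have hsplit : ∀ Γ : Matrix V V ℝ, ∑ i, ∑ j, Γ i j - k * Γ.trace
      = ∑ i, (∑ j ∈ Finset.univ.erase i, Γ i j - (k - 1) * Γ i i) := fun Γ => by
    simp only [Finset.sum_sub_distrib, ← Finset.mul_sum, trace, diag_apply]
    have : ∀ i, ∑ j, Γ i j = ∑ j ∈ Finset.univ.erase i, Γ i j + Γ i i := fun i =>
      (Finset.sum_erase_add _ _ (Finset.mem_univ i)).symm
    simp only [this, Finset.sum_add_distrib]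
    ring
  have hk' : (0 : ℝ) ≤ k - 1 := by
    have : (1 : ℝ) ≤ k := by exact_mod_cast hk
    linarith
  rw [omega, omega, hsplit, hsplit]
  refine Finset.sum_le_sum fun i _ => sub_le_sub (le_of_eq ?_)
    (mul_le_mul_of_nonneg_left (hdiag i) hk')
  exact Finset.sum_congr rfl fun j hj => hoff i j (Finset.ne_of_mem_erase hj).symm

end LocalChannels

/-! ### The source state of a network -/

section Sources

variable {V : Type*} [Fintype V] [DecidableEq V] {E : Finset (Finset V)} {D : Finset V → V → ℕ}

/-- Regrouping the particles distributed by a network: by party or by source. -/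
def regroup (E : Finset (Finset V)) (D : Finset V → V → ℕ) :
    (∀ v, PartyIdx E D v) ≃ (∀ e : {e : Finset V // e ∈ E}, SourceIdx D e) where
  toFun x e v := x v ⟨e.1, e.2, v.2⟩
  invFun y v e := y ⟨e.1, e.2.1⟩ ⟨v, e.2.2⟩
  left_inv _ := rfl
  right_inv _ := rfl

omit [Fintype V] [DecidableEq V] in
theorem sourceState_eq_submatrix
    (γ : ∀ e : {e : Finset V // e ∈ E}, Matrix (SourceIdx D e) (SourceIdx D e) ℂ) :
    sourceState E D γ = (tensorOp γ).submatrix (regroup E D) (regroup E D) := rfl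

theorem trace_submatrix_equiv {I J : Type*} [Fintype I] [Fintype J] (f : I ≃ J)
    (X : Matrix J J ℂ) : (X.submatrix f f).trace = X.trace :=
  Equiv.sum_comp f fun i => X i i

theorem trace_sourceState_mul
    (γ : ∀ e : {e : Finset V // e ∈ E}, Matrix (SourceIdx D e) (SourceIdx D e) ℂ)
    (Z : Matrix (∀ v, PartyIdx E D v) (∀ v, PartyIdx E D v) ℂ) :
    (sourceState E D γ * Z).trace =
      (tensorOp γ * Z.submatrix (regroup E D).symm (regroup E D).symm).trace := by
  rw [← trace_submatrix_equiv (regroup E D), ← submatrix_mul_equiv _ _ _ (regroup E D) _,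
    sourceState_eq_submatrix, submatrix_submatrix]
  simp

theorem IsState.sourceState
    {γ : ∀ e : {e : Finset V // e ∈ E}, Matrix (SourceIdx D e) (SourceIdx D e) ℂ}
    (hγ : ∀ e, IsState (γ e)) : IsState (sourceState E D γ) := by
  choose g hg using fun e => exists_eq_mul_conjTranspose (hγ e).1
  refine ⟨(tensorOp_posSemidef hg).submatrix _, ?_⟩
  rw [sourceState_eq_submatrix, trace_submatrix_equiv, trace_tensorOp,
    Finset.prod_congr rfl fun e _ => (hγ e).2, Finset.prod_const_one]

/-- The network structure enters here: a party outside e holds no particle of e. -/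
theorem actsTrivially_regroup_localOp {v : V} {e : {e : Finset V // e ∈ E}} (hv : v ∉ e.1)
    (B : Matrix (PartyIdx E D v) (PartyIdx E D v) ℂ) :
    ActsTrivially (J := fun e : {e : Finset V // e ∈ E} => SourceIdx D e) e
      ((localOp v B).submatrix (regroup E D).symm (regroup E D).symm) := by
  refine ⟨fun x y h => ?_, fun x y a h => ?_⟩
  · rw [submatrix_apply, localOp_apply, if_neg, mul_zero]
    refine fun hxy => h (funext fun u => ?_)
    have hu : u.1 ≠ v := fun hu => hv (hu ▸ u.2)
    exact congrFun (hxy u hu) ⟨e.1, e.2, u.2⟩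
  · rw [submatrix_apply, submatrix_apply, localOp_apply, localOp_apply]
    have hloc : ∀ z : ∀ e : {e : Finset V // e ∈ E}, SourceIdx D e,
        (regroup E D).symm (Function.update z e a) v = (regroup E D).symm z v := fun z => by
      funext f
      have hf : (⟨f.1, f.2.1⟩ : {e : Finset V // e ∈ E}) ≠ e := fun hf =>
        hv (hf ▸ f.2.2)
      exact congrFun (Function.update_of_ne hf a z) _
    rw [hloc, hloc]
    congr 1
    refine if_congr (forall_congr' fun w => imp_congr_right fun _ => ?_) rfl rfl
    rw [funext_iff, funext_iff]
    refine forall_congr' fun f => ?_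
    by_cases hf : (⟨f.1, f.2.1⟩ : {e : Finset V // e ∈ E}) = e
    · refine iff_of_true ?_ ?_
      · change Function.update x e a ⟨f.1, f.2.1⟩ _ = Function.update y e a ⟨f.1, f.2.1⟩ _
        subst hf
        simp only [Function.update_self]
      · change x ⟨f.1, f.2.1⟩ _ = y ⟨f.1, f.2.1⟩ _
        subst hf
        exact congrFun h _
    · change Function.update x e a ⟨f.1, f.2.1⟩ _ = Function.update y e a ⟨f.1, f.2.1⟩ _ ↔
        x ⟨f.1, f.2.1⟩ _ = y ⟨f.1, f.2.1⟩ _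
      rw [Function.update_of_ne hf, Function.update_of_ne hf]

theorem omega_sourceState_nonpos {k : ℕ} (hE : IsKNetwork k E)
    {γ : ∀ e : {e : Finset V // e ∈ E}, Matrix (SourceIdx D e) (SourceIdx D e) ℂ}
    (hγ : ∀ e, IsState (γ e)) {M : ∀ v, Matrix (PartyIdx E D v) (PartyIdx E D v) ℂ}
    (hM : ∀ v, (M v)ᴴ = M v) : omega k M (sourceState E D γ) ≤ 0 := by
  have h := product_covariance_le hγ (fun e => e.1) (fun e => hE e.1 e.2)
    (fun v => (localOp v (M v)).submatrix (regroup E D).symm (regroup E D).symm)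
    (fun v => by rw [conjTranspose_submatrix, localOp_conjTranspose, hM])
    (fun e v hv => actsTrivially_regroup_localOp hv (M v))
  simp only [submatrix_mul_equiv, ← trace_sourceState_mul] at h
  exact sub_nonpos.2 h

end Sources

/-! ### Passage to the closure -/

section NetStates

variable {V : Type*} [Fintype V] [DecidableEq V] {H : V → Type*} [∀ v, Fintype (H v)]
  [∀ v, DecidableEq (H v)] {E : Finset (Finset V)}

theorem continuous_re_trace_mul {I : Type*} [Fintype I] (B : Matrix I I ℂ) :
    Continuous fun σ : Matrix I I ℂ => (σ * B).trace.re :=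
  Complex.continuous_re.comp (continuous_id.matrix_mul continuous_const).matrix_trace

theorem continuous_omega (k : ℕ) (M : ∀ v, Matrix (H v) (H v) ℂ) :
    Continuous fun σ => omega k M σ := by
  have h : ∀ i j, Continuous fun σ => cov M σ i j := fun i j =>
    (continuous_re_trace_mul _).sub
      ((continuous_re_trace_mul _).mul (continuous_re_trace_mul _))
  exact (continuous_finsetSum _ fun i _ => continuous_finsetSum _ fun j _ => h i j).sub
    (continuous_const.mul (continuous_finsetSum _ fun i _ => h i i))

omit [∀ v, DecidableEq (H v)] in
theorem isState_of_mem_preparable {σ : Matrix (∀ v, H v) (∀ v, H v) ℂ}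
    (hσ : σ ∈ preparable H E) : IsState σ := by
  classical
  obtain ⟨D, γ, m, A, hγ, hA, rfl⟩ := hσ
  exact IsState.applyLocal hA (IsState.sourceState hγ)

theorem omega_nonpos_of_mem_netStates {k : ℕ} (hk : 1 ≤ k) (hE : IsKNetwork k E)
    {M : ∀ v, Matrix (H v) (H v) ℂ} (hM : IsMeasurement M)
    {σ : Matrix (∀ v, H v) (∀ v, H v) ℂ} (hσ : σ ∈ netStates H E) : omega k M σ ≤ 0 := by
  refine closure_minimal ?_ (isClosed_le (continuous_omega k M) continuous_const) hσ
  rintro _ ⟨D, γ, m, A, hγ, hA, rfl⟩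
  exact (omega_applyLocal_le hA hk hM (IsState.sourceState hγ).1).trans
    (omega_sourceState_nonpos hE hγ fun v => (IsObs.dualOp (hA v) (hM v)).isHermitian)

theorem abs_re_trace_mul_le_one_of_mem_netStates {B : Matrix (∀ v, H v) (∀ v, H v) ℂ}
    (hB : IsObs B) {σ : Matrix (∀ v, H v) (∀ v, H v) ℂ} (hσ : σ ∈ netStates H E) :
    |(σ * B).trace.re| ≤ 1 :=
  closure_minimal (s := preparable H E)
    (fun _ hσ' => abs_re_trace_mul_obs_le (isState_of_mem_preparable hσ') hB)
    (isClosed_le (continuous_re_trace_mul B).abs continuous_const) hσ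

end NetStates

/-! ### Quantitative bounds on ω -/

section Bound

variable {V : Type*} [Fintype V] [DecidableEq V]

/-- The coefficients `1 - k δ_ij` of `ω`. -/
def coeff (k : ℕ) (i j : V) : ℝ := 1 - if i = j then (k : ℝ) else 0

theorem sum_sub_mul_trace_eq (k : ℕ) (Γ : Matrix V V ℝ) :
    ∑ i, ∑ j, Γ i j - k * Γ.trace = ∑ i, ∑ j, coeff k i j * Γ i j := by
  simp only [coeff, sub_mul, one_mul, ite_mul, zero_mul, Finset.sum_sub_distrib,
    Finset.sum_ite_eq, Finset.mem_univ, if_true, trace, diag_apply, Finset.mul_sum]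

theorem sum_coeff_mul_le {k : ℕ} (hk : 1 ≤ k) {Γ : V → V → ℝ} {c : ℝ}
    (h : ∀ i j, |Γ i j| ≤ c) :
    ∑ i, ∑ j, coeff k i j * Γ i j
      ≤ (Fintype.card V : ℝ) * ((Fintype.card V : ℝ) + k - 2) * c := by
  have hk' : (1 : ℝ) ≤ k := by exact_mod_cast hk
  -- The factor is |1 - kδ_ij|: on the diagonal 1 + (k - 2) = k - 1.
  have h1 : ∀ i j : V, coeff k i j * Γ i j ≤ (1 + if i = j then (k - 2 : ℝ) else 0) * c := by
    intro i j
    have h2 := abs_le.1 (h i j)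
    rw [coeff]
    split_ifs
    · nlinarith
    · linarith
  refine (Finset.sum_le_sum fun i _ => Finset.sum_le_sum fun j _ => h1 i j).trans
    (le_of_eq ?_)
  simp only [← Finset.sum_mul, Finset.sum_add_distrib, Finset.sum_const, Finset.sum_ite_eq,
    Finset.mem_univ, if_true, Finset.card_univ, nsmul_eq_mul]
  ring

variable {H : V → Type*} [∀ v, Fintype (H v)] [∀ v, DecidableEq (H v)]
  {M : ∀ v, Matrix (H v) (H v) ℂ} {ρ : Matrix (∀ v, H v) (∀ v, H v) ℂ}

/-- The constant 3 counts one |ρ - σ|₁ for the joint expectation and two for the product of means,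
changed one factor at a time. -/
theorem abs_cov_sub_cov_le (hM : IsMeasurement M) (hρ : IsState ρ) {E : Finset (Finset V)}
    {σ : Matrix (∀ v, H v) (∀ v, H v) ℂ} (hσ : σ ∈ netStates H E) (i j : V) :
    |cov M ρ i j - cov M σ i j| ≤ 3 * traceNorm (ρ - σ) := by
  have hobs : ∀ v, IsObs (localOp v (M v)) := fun v => IsObs.localOp (hM v)
  have hdiff : ∀ {B}, IsContraction B → |(ρ * B).trace.re - (σ * B).trace.re|
      ≤ traceNorm (ρ - σ) := fun hB => by
    rw [← Complex.sub_re, ← trace_sub, ← sub_mul]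
    exact abs_re_trace_mul_le_traceNorm _ hB
  have h1 := hdiff ((hobs i).isContraction.mul (hobs j).isContraction)
  have h2 := hdiff (hobs i).isContraction
  have h3 := hdiff (hobs j).isContraction
  have h4 := abs_re_trace_mul_obs_le hρ (hobs i)
  have h5 := abs_re_trace_mul_le_one_of_mem_netStates (hobs j) hσ
  simp only [cov, of_apply]
  generalize (ρ * localOp i (M i)).trace.re = a at *
  generalize (ρ * localOp j (M j)).trace.re = b at *
  generalize (σ * localOp i (M i)).trace.re = a' at *
  generalize (σ * localOp j (M j)).trace.re = b' at *
  generalize (ρ * (localOp i (M i) * localOp j (M j))).trace.re = c at *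
  generalize (σ * (localOp i (M i) * localOp j (M j))).trace.re = c' at *
  have h6 : |a * (b - b')| ≤ traceNorm (ρ - σ) := by
    rw [abs_mul]
    exact (mul_le_of_le_one_left (abs_nonneg _) h4).trans h3
  have h7 : |(a - a') * b'| ≤ traceNorm (ρ - σ) := by
    rw [abs_mul]
    exact (mul_le_of_le_one_right (abs_nonneg _) h5).trans h2
  rw [show c - a * b - (c' - a' * b') = (c - c') - a * (b - b') - (a - a') * b' by ring]
  rw [abs_le] at *
  constructor <;> linarith

theorem omega_le_traceNorm {k : ℕ} (hk : 1 ≤ k) {E : Finset (Finset V)} (hE : IsKNetwork k E)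
    (hM : IsMeasurement M) (hρ : IsState ρ) {σ : Matrix (∀ v, H v) (∀ v, H v) ℂ}
    (hσ : σ ∈ netStates H E) :
    omega k M ρ ≤ 6 * (Fintype.card V : ℝ) * ((Fintype.card V : ℝ) + k - 2)
      * (traceNorm (ρ - σ) / 2) := by
  have h1 := omega_nonpos_of_mem_netStates hk hE hM hσ
  have h2 := sum_coeff_mul_le hk (abs_cov_sub_cov_le hM hρ hσ)
  simp only [mul_sub, Finset.sum_sub_distrib, ← sum_sub_mul_trace_eq] at h2
  rw [omega] at h1 ⊢
  linarith

/-- Law of total covariance: joint expectations are linear in the state and cancel, leaving the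
covariance over t of the local means, which is at most the average of two variances. -/
theorem omega_sub_average_le {k : ℕ} (hk : 1 ≤ k) (hM : IsMeasurement M) (hρ : IsState ρ)
    {N : ℕ} {p : Fin N → ℝ} {ρt : Fin N → Matrix (∀ v, H v) (∀ v, H v) ℂ}
    (h : IsDecomposition p ρt ρ) :
    omega k M ρ - ∑ t, p t * omega k M (ρt t)
      ≤ (Fintype.card V : ℝ) * ((Fintype.card V : ℝ) + k - 2) * beta ρ := by
  set a : V → ℝ := fun i => (ρ * localOp i (M i)).trace.re with ha
  set b : Fin N → V → ℝ := fun t i => (ρt t * localOp i (M i)).trace.re with hb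
  have hab : ∀ i, ∑ t, p t * b t i = a i := fun i => h.re_trace_mul _
  have hvar : ∀ i, ∑ t, p t * (b t i - a i) ^ 2 ≤ beta ρ := fun i =>
    h.variance_le_beta hρ (IsObs.localOp (hM i))
  have hcov : ∀ i j, cov M ρ i j - ∑ t, p t * cov M (ρt t) i j
      = ∑ t, p t * ((b t i - a i) * (b t j - a j)) := fun i j => by
    have h1 : ∀ t, p t * cov M (ρt t) i j
        = p t * (ρt t * (localOp i (M i) * localOp j (M j))).trace.re - p t * (b t i * b t j) :=
      fun t => by simp only [cov, of_apply, hb]; ring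
    have h2 : ∀ t, p t * ((b t i - a i) * (b t j - a j)) = p t * (b t i * b t j)
        - a j * (p t * b t i) - a i * (p t * b t j) + a i * a j * p t := fun t => by ring
    simp only [h1, h2, Finset.sum_add_distrib, Finset.sum_sub_distrib, ← Finset.mul_sum, hab,
      h.2.1, h.re_trace_mul]
    simp only [cov, of_apply, ha]
    ring
  have habs : ∀ i j, |cov M ρ i j - ∑ t, p t * cov M (ρt t) i j| ≤ beta ρ := fun i j => by
    have hi := hvar i
    have hj := hvar j
    have h1 : ∑ t, p t * |(b t i - a i) * (b t j - a j)|
        ≤ (∑ t, p t * (b t i - a i) ^ 2 + ∑ t, p t * (b t j - a j) ^ 2) / 2 := by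
      rw [← Finset.sum_add_distrib, Finset.sum_div]
      refine Finset.sum_le_sum fun t _ => ?_
      have h2 : |(b t i - a i) * (b t j - a j)|
          ≤ ((b t i - a i) ^ 2 + (b t j - a j) ^ 2) / 2 := by
        rw [abs_le]
        constructor <;> nlinarith [sq_nonneg (b t i - a i + (b t j - a j)),
          sq_nonneg (b t i - a i - (b t j - a j))]
      linarith [mul_le_mul_of_nonneg_left h2 (h.1 t)]
    rw [hcov]
    refine (Finset.abs_sum_le_sum_abs _ _).trans ?_
    simp only [abs_mul (p _), abs_of_nonneg (h.1 _)]
    linarith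
  have key := sum_coeff_mul_le hk habs
  refine le_trans (le_of_eq ?_) key
  simp only [omega, sum_sub_mul_trace_eq, mul_sub, Finset.sum_sub_distrib, Finset.mul_sum]
  congr 1
  rw [Finset.sum_comm]
  refine Finset.sum_congr rfl fun i _ => ?_
  rw [Finset.sum_comm]
  exact Finset.sum_congr rfl fun j _ => Finset.sum_congr rfl fun t _ => by ring

end Bound

end QNet

end

theorem mainTheorem12 {V : Type*} [Fintype V] [DecidableEq V] [Nonempty V]
    {H : V → Type*} [∀ v, Fintype (H v)] [∀ v, DecidableEq (H v)]
    (k : ℕ) (hk : 1 ≤ k) (hnk : 2 < Fintype.card V + k)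
    (E : Finset (Finset V)) (hE : QNet.IsKNetwork k E)
    (M : ∀ v, Matrix (H v) (H v) ℂ) (hM : QNet.IsMeasurement M)
    (ρ : Matrix (∀ v, H v) (∀ v, H v) ℂ) (hρ : QNet.IsState ρ) :
    QNet.omega k M ρ / (6 * (Fintype.card V : ℝ) * ((Fintype.card V : ℝ) + k - 2))
      - QNet.beta ρ / 6 ≤ QNet.Etr E ρ := by
  -- Nonemptiness matters: the real infimum of the empty set is 0 by convention, while the bound may
  -- be positive.
  refine le_csInf (QNet.trValues_nonempty E hρ) ?_
  rintro _ ⟨N, p, ρt, σt, hp, hp1, hρt, hdec, hσ, rfl⟩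
  have hn : (0 : ℝ) < Fintype.card V := by exact_mod_cast Fintype.card_pos
  have hnk' : (0 : ℝ) < (Fintype.card V : ℝ) + k - 2 := by
    have : (2 : ℝ) < (Fintype.card V : ℝ) + k := by exact_mod_cast hnk
    linarith
  have h1 := QNet.omega_sub_average_le hk hM hρ ⟨hp, hp1, hρt, hdec⟩
  have h2 : ∑ t, p t * QNet.omega k M (ρt t) ≤
      ∑ t, p t * (6 * (Fintype.card V : ℝ) * ((Fintype.card V : ℝ) + k - 2)
        * (QNet.traceNorm (ρt t - σt t) / 2)) :=
    Finset.sum_le_sum fun t _ => mul_le_mul_of_nonneg_left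
      (QNet.omega_le_traceNorm hk hE hM (hρt t) (hσ t)) (hp t)
  simp only [mul_left_comm (p _), ← Finset.mul_sum] at h2
  rw [sub_le_iff_le_add, div_le_iff₀ (by positivity)]
  linarith
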